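/- Let $G$ be a group with a generating family $S=(a,b)$ of two elements. For $n\ge 0$ let $r_n$ be the number of words of length $n$ in the four letters $a,a^{-1},b,b^{-1}$ that represent the identity of $G$ (the letters being regarded as distinct formal symbols), and let $p_n$ be the number of those among them that are freely reduced, i.e. contain no subword $aa^{-1}$, $a^{-1}a$, $bb^{-1}$ or $b^{-1}b$. Put $$\rho(G,S)=\limsup_{n\to\infty} r_n^{1/n},\qquad \alpha(G,S)=\limsup_{n\to\infty} p_n^{1/n}.$$ Consider the Baumslag--Solitar groups $BS(p,q)=\langle a,b\mid b a^p b^{-1}=a^q\rangle$ and Thompson's group $$F=\langle a,b\mid [ab^{-1},a^{-1}ba],\ [ab^{-1},a^{-2}ba^{2}]\rangle ,\qquad [x,y]=xyx^{-1}y^{-1},$$ each with its two standard generators $a,b$. Then $$\alpha(BS(2,2))\ge 2.5904,\quad \alpha(BS(2,3))\ge 2.42579,\quad \alpha(BS(3,5))\ge 2.06357,\quad \alpha(F)\ge 2.17329,$$ and $$\rho(BS(2,2))\ge 3.78522,\quad \rho(BS(2,3))\ge 3.66250,\quad \rho(BS(3,5))\ge 3.51736,\quad \rho(F)\ge 3.55368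 .$$ -/

import Mathlib

noncomputable section

open scoped commutatorElement

namespace Cogrowth

/-- The value in `G` of a word over the letters `s i` and `(s i)⁻¹`: the letter `(i, true)`
stands for `s i` and the letter `(i, false)` for its formal inverse. -/
def wordValue {G ι : Type} [Group G] (s : ι → G) (w : List (ι × Bool)) : G :=
  (w.map fun x => if x.2 then s x.1 else (s x.1)⁻¹).prod

/-- The words of length `n` that represent the identity; they are the paths of length `n` in the
labelled Cayley graph that start and end at the identity. -/
def returns {G ι : Type} [Group G] (s : ι → G) (n : ℕ) : Set (List (ι × Bool)) :=
  {w | w.length = n ∧ wordValue s w = 1}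

/-- The freely reduced words of length `n` that represent the identity (closed paths without
immediate reversals). -/
def reducedReturns {G ι : Type} [Group G] (s : ι → G) (n : ℕ) : Set (List (ι × Bool)) :=
  {w | w ∈ returns s n ∧ FreeGroup.IsReduced w}

/-- `r_n` -/
def numReturns {G ι : Type} [Group G] (s : ι → G) (n : ℕ) : ℕ :=
  (returns s n).ncard

/-- `p_n` -/
def numReducedReturns {G ι : Type} [Group G] (s : ι → G) (n : ℕ) : ℕ :=
  (reducedReturns s n).ncard

/-- `ρ = limsup r_n ^ (1/n)`, the growth rate of all trivial words. For finite `ι` the sequence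
lies between `0` and `2 * card ι` (see `numReturns_le`), so the real limsup is a genuine one. -/
def rho {G ι : Type} [Group G] (s : ι → G) : ℝ :=
  Filter.limsup (fun n : ℕ => (numReturns s n : ℝ) ^ (1 / (n : ℝ))) Filter.atTop

/-- `α = limsup p_n ^ (1/n)`, the growth rate of the freely reduced trivial words. -/
def alpha {G ι : Type} [Group G] (s : ι → G) : ℝ :=
  Filter.limsup (fun n : ℕ => (numReducedReturns s n : ℝ) ^ (1 / (n : ℝ))) Filter.atTop

theorem returns_finite {G ι : Type} [Group G] [Finite ι] (s : ι → G) (n : ℕ) :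
    (returns s n).Finite :=
  (List.finite_length_eq (ι × Bool) n).subset fun _ h => h.1

theorem numReturns_le {G ι : Type} [Group G] [Fintype ι] (s : ι → G) (n : ℕ) :
    numReturns s n ≤ (2 * Fintype.card ι) ^ n := by
  have h : (returns s n).ncard ≤ {w : List (ι × Bool) | w.length = n}.ncard :=
    Set.ncard_le_ncard (fun _ h => h.1) (List.finite_length_eq (ι × Bool) n)
  refine h.trans (le_of_eq ?_)
  have e : {w : List (ι × Bool) | w.length = n}.ncard = Nat.card (List.Vector (ι × Bool) n) := rfl
  rw [e, Nat.card_eq_fintype_card, card_vector, Fintype.card_prod, Fintype.card_bool, mul_comm]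

theorem numReducedReturns_le {G ι : Type} [Group G] [Finite ι] (s : ι → G) (n : ℕ) :
    numReducedReturns s n ≤ numReturns s n :=
  Set.ncard_le_ncard (fun _ h => h.1) (returns_finite s n)

/-- The free generator `a` of the free group on two letters. -/
def fa : FreeGroup (Fin 2) := FreeGroup.of 0

/-- The free generator `b` of the free group on two letters. -/
def fb : FreeGroup (Fin 2) := FreeGroup.of 1

/-- Baumslag–Solitar group `BS(p,q) = ⟨a, b ∣ b a^p b⁻¹ = a^q⟩`. -/
abbrev BS (p q : ℕ) : Type :=
  PresentedGroup ({fb * fa ^ p * fb⁻¹ * (fa ^ q)⁻¹} : Set (FreeGroup (Fin 2)))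

/-- The generators `a, b` of `BS(p,q)`. -/
def bsGen (p q : ℕ) : Fin 2 → BS p q := fun i => PresentedGroup.of i

/-- Thompson's group `F = ⟨a, b ∣ [a b⁻¹, a⁻¹ b a], [a b⁻¹, a⁻² b a²]⟩`,
where `[x, y] = x y x⁻¹ y⁻¹`. -/
abbrev ThompsonF : Type :=
  PresentedGroup ({⁅fa * fb⁻¹, fa⁻¹ * fb * fa⁆,
    ⁅fa * fb⁻¹, (fa ^ 2)⁻¹ * fb * fa ^ 2⁆} : Set (FreeGroup (Fin 2)))

/-- The generators `a, b` of Thompson's group `F`. -/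
def thompsonGen : Fin 2 → ThompsonF := fun i => PresentedGroup.of i

end Cogrowth

end

/-!
A finite graph that immerses in the Cayley graph of `(G, S)` bounds `ρ` from below: the entries of
the powers of its adjacency matrix `A` count words with prescribed values, so comparing the trace
of `A ^ n` with `r_n` shows that every eigenvalue of `A`, hence every Rayleigh quotient, is at most
`ρ`. Passing from a word to its free reduction turns a bound on `p_n` into one on `r_n`: if
`1 ≤ c` and `α < c`, then `ρ ≤ c + (2 k - 1) / c` for `k` generators, because summing the function
`c⁻¹ ^ |x|` over the neighbours of a point of the free group multiplies its value by at most
`c + (2 k - 1) / c`. So a good lower bound on `ρ` gives one on `α`.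

In Thompson's group the graphs consist of forest diagrams, with a product state whose factors weight
a tree according to the heights of its subtrees. In `BS(p, q)` they consist of segments of the
`a`-lines over a ball of the Bass–Serre tree, with a periodic profile along each line. The outermost
lines and the ends of the segments carry a share of the mass that tends to `0` as the ball grows, so
only a finite inequality between rational numbers has to be checked for one line and its branches.
-/

namespace Cogrowth

open Filter Topology

/-! ### Real sequences and their growth rates -/

theorem nonpos_of_forall_nat_mul_le {x C : ℝ} (h : ∀ n : ℕ, n * x ≤ C) : x ≤ 0 := by
  by_contra! hx
  obtain ⟨n, hn⟩ := exists_nat_gt (C / x)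
  exact ((div_lt_iff₀ hx).1 hn).not_ge (h n)

theorem sum_range_mul_of_periodic {f : ℕ → ℝ} {P : ℕ} (hf : Function.Periodic f P) (k : ℕ) :
    ∑ m ∈ Finset.range (P * k), f m = k * ∑ m ∈ Finset.range P, f m := by
  induction k with
  | zero => simp
  | succ k ih =>
    have hshift : ∀ m, f (P * k + m) = f m := fun m => by
      rw [add_comm, mul_comm]
      exact hf.nat_mul k m
    rw [mul_add, mul_one, Finset.sum_range_add, ih]
    simp only [hshift]
    push_cast
    ring

section GrowthRate

/-- The exponential growth rate `limsup u_n ^ (1/n)` of a sequence; `rho` and `alpha` are the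
growth rates of `numReturns` and `numReducedReturns`. -/
noncomputable def growthRate (u : ℕ → ℝ) : ℝ :=
  limsup (fun n : ℕ => u n ^ (1 / (n : ℝ))) atTop

theorem tendsto_mul_pow_rpow_inv {c l : ℝ} (hc : 0 < c) (hl : 0 ≤ l) :
    Tendsto (fun n : ℕ => (c * l ^ n) ^ (1 / (n : ℝ))) atTop (𝓝 l) := by
  have hroot : Tendsto (fun n : ℕ => c ^ (1 / (n : ℝ))) atTop (𝓝 (c ^ (0 : ℝ))) :=
    (Real.continuousAt_const_rpow hc.ne').tendsto.comp tendsto_one_div_atTop_nhds_zero_nat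
  rw [Real.rpow_zero] at hroot
  refine (by simpa using hroot.mul_const l : Tendsto _ _ (𝓝 l)).congr' ?_
  filter_upwards [eventually_ne_atTop 0] with n hn
  rw [Real.mul_rpow hc.le (pow_nonneg hl n), one_div, Real.pow_rpow_inv_natCast hl hn]

variable {u : ℕ → ℝ}

theorem isBoundedUnder_rpow_inv (hu : ∀ n, 0 ≤ u n) {M : ℝ} (hM : 0 ≤ M)
    (h : ∀ n, u n ≤ M ^ n) :
    IsBoundedUnder (· ≤ ·) atTop fun n : ℕ => u n ^ (1 / (n : ℝ)) := by
  refine isBoundedUnder_of_eventually_le (a := M) ?_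
  filter_upwards [eventually_ne_atTop 0] with n hn
  calc u n ^ (1 / (n : ℝ)) ≤ (M ^ n) ^ (1 / (n : ℝ)) := by gcongr; exacts [hu n, h n]
    _ = M := by rw [one_div, Real.pow_rpow_inv_natCast hM hn]

theorem isCoboundedUnder_rpow_inv (hu : ∀ n, 0 ≤ u n) :
    IsCoboundedUnder (· ≤ ·) atTop fun n : ℕ => u n ^ (1 / (n : ℝ)) :=
  (isBoundedUnder_of ⟨0, fun n => Real.rpow_nonneg (hu n) _⟩).isCoboundedUnder_le

theorem le_growthRate_of_frequently (hu : ∀ n, 0 ≤ u n) {M : ℝ} (hM : 0 ≤ M)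
    (h : ∀ n, u n ≤ M ^ n) {c l : ℝ} (hc : 0 < c) (hl : 0 ≤ l)
    (hfreq : ∃ᶠ n in atTop, c * l ^ n ≤ u n) : l ≤ growthRate u := by
  refine le_of_forall_lt_imp_le_of_dense fun m hm => ?_
  refine le_limsup_of_frequently_le ?_ (isBoundedUnder_rpow_inv hu hM h)
  have hlim := (tendsto_mul_pow_rpow_inv hc hl).eventually_const_lt hm
  refine (hfreq.and_eventually hlim).mono fun n ⟨hn, hmn⟩ => hmn.le.trans ?_
  gcongr

theorem growthRate_le (hu : ∀ n, 0 ≤ u n) {c l : ℝ} (hc : 0 < c) (hl : 0 ≤ l)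
    (h : ∀ n, u n ≤ c * l ^ n) : growthRate u ≤ l := by
  have hlim := tendsto_mul_pow_rpow_inv hc hl
  refine (limsup_le_limsup (Eventually.of_forall fun n => ?_) (isCoboundedUnder_rpow_inv hu)
    hlim.isBoundedUnder_le).trans_eq hlim.limsup_eq
  gcongr
  exacts [hu n, h n]

theorem eventually_le_pow_of_growthRate_lt (hu : ∀ n, 0 ≤ u n) {M : ℝ} (hM : 0 ≤ M)
    (h : ∀ n, u n ≤ M ^ n) {c : ℝ} (hc : growthRate u < c) : ∀ᶠ n in atTop, u n ≤ c ^ n := by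
  filter_upwards [eventually_lt_of_limsup_lt hc (isBoundedUnder_rpow_inv hu hM h),
    eventually_ne_atTop 0] with n hn hn0
  calc u n = (u n ^ (1 / (n : ℝ))) ^ n := by rw [one_div, Real.rpow_inv_natCast_pow (hu n) hn0]
    _ ≤ c ^ n := pow_le_pow_left₀ (Real.rpow_nonneg (hu n) _) hn.le n

end GrowthRate

/-! ### Words with a given value -/

section Words

open FreeGroup

variable {G ι : Type} [Group G]

/-- The value of a single letter of a word. -/
def letterValue (s : ι → G) (x : ι × Bool) : G :=
  if x.2 then s x.1 else (s x.1)⁻¹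

/-- The number of words of length `n` with value `g`; `numReturns` is the case `g = 1`. -/
noncomputable def numWords (s : ι → G) (n : ℕ) (g : G) : ℕ :=
  {w : List (ι × Bool) | w.length = n ∧ wordValue s w = g}.ncard

theorem wordValue_cons (s : ι → G) (x : ι × Bool) (w : List (ι × Bool)) :
    wordValue s (x :: w) = letterValue s x * wordValue s w := by
  simp only [wordValue, letterValue, List.map_cons, List.prod_cons]

theorem wordValue_eq_lift (s : ι → G) (w : List (ι × Bool)) :
    wordValue s w = lift s (mk w) := by
  rw [lift_mk, wordValue]
  congr! 3 with x
  cases x.2 <;> rfl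

theorem wordValue_freeGroup_of (w : List (ι × Bool)) :
    wordValue (of : ι → FreeGroup ι) w = mk w := by
  rw [wordValue_eq_lift, lift_of_eq_id, MonoidHom.id_apply]

theorem finite_setOf_wordValue_eq [Finite ι] (s : ι → G) (n : ℕ) (g : G) :
    {w : List (ι × Bool) | w.length = n ∧ wordValue s w = g}.Finite :=
  (List.finite_length_eq (ι × Bool) n).subset fun _ h => h.1

theorem numWords_one (s : ι → G) (n : ℕ) : numWords s n 1 = numReturns s n := rfl

theorem numWords_zero (s : ι → G) (g : G) [Decidable (g = 1)] :
    numWords s 0 g = if g = 1 then 1 else 0 := by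
  have hset : {w : List (ι × Bool) | w.length = 0 ∧ wordValue s w = g} =
      {w | w = [] ∧ g = 1} := by
    ext w
    cases w
    · exact and_congr (iff_of_true rfl rfl) eq_comm
    · simp
  rw [numWords, hset]
  split_ifs with hg <;> simp [hg]

theorem numWords_succ [Fintype ι] (s : ι → G) (n : ℕ) (g : G) :
    numWords s (n + 1) g = ∑ x : ι × Bool, numWords s n ((letterValue s x)⁻¹ * g) := by
  have hunion : {w : List (ι × Bool) | w.length = n + 1 ∧ wordValue s w = g} =
      ⋃ x : ι × Bool,
        List.cons x '' {w | w.length = n ∧ wordValue s w = (letterValue s x)⁻¹ * g} := by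
    ext w
    cases w <;> simp [wordValue_cons, eq_inv_mul_iff_mul_eq]
  have hdisj : Pairwise fun x y : ι × Bool => Disjoint
      (List.cons x '' {w | w.length = n ∧ wordValue s w = (letterValue s x)⁻¹ * g})
      (List.cons y '' {w | w.length = n ∧ wordValue s w = (letterValue s y)⁻¹ * g}) := by
    intro x y hxy
    rw [Set.disjoint_left]
    rintro _ ⟨v, -, rfl⟩ ⟨w, -, h⟩
    exact hxy (List.cons.inj h).1.symm
  rw [numWords, hunion, Set.ncard_iUnion_of_finite
    (fun _ => (finite_setOf_wordValue_eq s n _).image _) hdisj, finsum_eq_sum_of_fintype]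
  exact Finset.sum_congr rfl fun x _ => Set.ncard_image_of_injective _ List.cons_injective

end Words

/-! ### Cogrowth -/

section FreeReduction

open FreeGroup

variable {G ι : Type} [Group G]

theorem norm_letterValue_inv_mul [DecidableEq ι] (x : FreeGroup ι) (y : ι × Bool) :
    ((letterValue of y)⁻¹ * x).norm =
      match x.toWord with
      | [] => 1
      | z :: w => if y = z then w.length else w.length + 2 := by
  have hmk : (letterValue of y)⁻¹ * x = mk ((y.1, !y.2) :: x.toWord) := by
    have hletter : letterValue of y = mk [y] := by
      rw [← wordValue_freeGroup_of, wordValue_cons, wordValue, List.map_nil, List.prod_nil,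
        mul_one]
    rw [hletter, inv_mk, ← mk_toWord (x := x), mul_mk, mk_toWord]
    rfl
  rw [FreeGroup.norm, hmk, toWord_mk, reduce.cons, reduce_toWord]
  rcases x.toWord with _ | ⟨z, w⟩
  · rfl
  · by_cases hyz : y = z
    · simp [hyz]
    · have hcancel : ¬(y.1 = z.1 ∧ y.2 = z.2) := by rwa [← Prod.ext_iff]
      simp [hcancel, hyz]

theorem reduce_mem_reducedReturns [DecidableEq ι] {s : ι → G} {n : ℕ} {w : List (ι × Bool)}
    (hw : w ∈ returns s n) : reduce w ∈ reducedReturns s (reduce w).length := by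
  refine ⟨⟨rfl, ?_⟩, isReduced_iff_reduce_eq.2 reduce.idem⟩
  rw [wordValue_eq_lift, reduce.self, ← wordValue_eq_lift, hw.2]

theorem sum_comp_length_le_tsum [Finite ι] {s : ι → G} {f : ℕ → ℝ} (hf : ∀ k, 0 ≤ f k)
    (hsum : Summable fun k => numReducedReturns s k * f k) (U : Finset (List (ι × Bool)))
    (hU : ∀ w ∈ U, w ∈ reducedReturns s w.length) :
    ∑ w ∈ U, f w.length ≤ ∑' k, numReducedReturns s k * f k := by
  rw [Finset.sum_comp f List.length]
  refine le_trans (Finset.sum_le_sum fun k _ => ?_)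
    (hsum.sum_le_tsum _ fun k _ => mul_nonneg (Nat.cast_nonneg _) (hf k))
  rw [nsmul_eq_mul]
  refine mul_le_mul_of_nonneg_right (Nat.cast_le.2 ?_) (hf k)
  rw [← Set.ncard_coe_finset]
  refine Set.ncard_le_ncard (fun w hw => ?_) ((returns_finite s k).subset fun _ h => h.1)
  obtain ⟨hwU, rfl⟩ := Finset.mem_filter.1 hw
  exact hU w hwU

theorem numReturns_cast_le [Fintype ι] (s : ι → G) (n : ℕ) :
    (numReturns s n : ℝ) ≤ (2 * Fintype.card ι : ℝ) ^ n := by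
  exact_mod_cast numReturns_le s n

theorem summable_numReducedReturns_mul_inv_pow [Finite ι] {s : ι → G} {c : ℝ} (hc : 0 < c)
    (h : alpha s < c) : Summable fun k => numReducedReturns s k * c⁻¹ ^ k := by
  cases nonempty_fintype ι
  obtain ⟨b, hb, hbc⟩ := exists_between (max_lt h hc)
  have hb0 : 0 < b := (le_max_right _ _).trans_lt hb
  have hgeom : Summable fun k : ℕ => (b / c) ^ k :=
    summable_geometric_of_lt_one (by positivity) ((div_lt_one hc).2 hbc)
  have hev : ∀ᶠ k in atTop, (numReducedReturns s k : ℝ) ≤ b ^ k :=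
    eventually_le_pow_of_growthRate_lt (fun _ => Nat.cast_nonneg _) (by positivity)
      (fun k => (Nat.cast_le.2 (numReducedReturns_le s k)).trans (numReturns_cast_le s k))
      ((le_max_left _ _).trans_lt hb)
  refine Summable.of_norm_bounded_eventually_nat hgeom ?_
  filter_upwards [hev] with k hk
  rw [Real.norm_of_nonneg (by positivity), div_eq_mul_inv, mul_pow]
  gcongr

variable [Fintype ι]

-- Exactly one letter shortens a nontrivial reduced word, all others lengthen it.
theorem sum_inv_pow_norm_le [DecidableEq ι] {c : ℝ} (hc : 1 ≤ c) (x : FreeGroup ι) :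
    ∑ y : ι × Bool, c⁻¹ ^ ((letterValue of y)⁻¹ * x).norm ≤
      (c + (2 * Fintype.card ι - 1) / c) * c⁻¹ ^ x.norm := by
  have hc0 : c ≠ 0 := (zero_lt_one.trans_le hc).ne'
  simp only [norm_letterValue_inv_mul]
  rw [FreeGroup.norm]
  rcases x.toWord with _ | ⟨z, w⟩
  · have hinv : c⁻¹ ≤ c := (inv_le_one_of_one_le₀ hc).trans hc
    simp only [Finset.sum_const, Finset.card_univ, Fintype.card_prod, Fintype.card_bool,
      List.length_nil, pow_zero, mul_one, pow_one, nsmul_eq_mul, div_eq_mul_inv]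
    push_cast
    linarith
  · have hsplit : ∀ y : ι × Bool, c⁻¹ ^ (if y = z then w.length else w.length + 2) =
        c⁻¹ ^ (w.length + 2) + if y = z then c⁻¹ ^ w.length - c⁻¹ ^ (w.length + 2) else 0 := by
      intro y
      split_ifs <;> ring
    simp only [hsplit, Finset.sum_add_distrib, Finset.sum_ite_eq', Finset.mem_univ, if_true,
      Finset.sum_const, Finset.card_univ, Fintype.card_prod, Fintype.card_bool, nsmul_eq_mul,
      List.length_cons, inv_pow]
    refine le_of_eq ?_
    push_cast
    field_simp [hc0]
    ring

theorem numWords_freeGroup_of_le [DecidableEq ι] {c : ℝ} (hc : 1 ≤ c)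
    (hμ : 0 ≤ c + (2 * Fintype.card ι - 1) / c) (n : ℕ) (x : FreeGroup ι) :
    (numWords of n x : ℝ) ≤ (c + (2 * Fintype.card ι - 1) / c) ^ n * c⁻¹ ^ x.norm := by
  induction n generalizing x with
  | zero =>
    rw [numWords_zero]
    split_ifs with hx
    · simp [hx]
    · rw [Nat.cast_zero]
      positivity
  | succ n ih =>
    rw [numWords_succ, Nat.cast_sum]
    calc _ ≤ ∑ y : ι × Bool, (c + (2 * Fintype.card ι - 1) / c) ^ n *
          c⁻¹ ^ ((letterValue of y)⁻¹ * x).norm := Finset.sum_le_sum fun y _ => ih _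
      _ ≤ (c + (2 * Fintype.card ι - 1) / c) ^ n *
          ((c + (2 * Fintype.card ι - 1) / c) * c⁻¹ ^ x.norm) := by
        rw [← Finset.mul_sum]
        exact mul_le_mul_of_nonneg_left (sum_inv_pow_norm_le hc x) (pow_nonneg hμ n)
      _ = _ := by ring

theorem numReturns_le_mul_tsum {s : ι → G} {c : ℝ} (hc : 1 ≤ c)
    (hμ : 0 ≤ c + (2 * Fintype.card ι - 1) / c)
    (hsum : Summable fun k => numReducedReturns s k * c⁻¹ ^ k) (n : ℕ) :
    (numReturns s n : ℝ) ≤ (c + (2 * Fintype.card ι - 1) / c) ^ n *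
      ∑' k, numReducedReturns s k * c⁻¹ ^ k := by
  classical
  set R := (returns_finite s n).toFinset
  have hfibre : ∀ u ∈ R.image reduce, ((R.filter fun w => reduce w = u).card : ℝ) ≤
      (c + (2 * Fintype.card ι - 1) / c) ^ n * c⁻¹ ^ u.length := by
    intro u hu
    obtain ⟨v, -, rfl⟩ := Finset.mem_image.1 hu
    refine le_trans ?_ (numWords_freeGroup_of_le hc hμ n (mk v))
    rw [Nat.cast_le, numWords, ← Set.ncard_coe_finset]
    refine Set.ncard_le_ncard (fun w hw => ?_) (finite_setOf_wordValue_eq _ n _)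
    obtain ⟨hwR, hwv⟩ := Finset.mem_filter.1 hw
    refine ⟨((Set.Finite.mem_toFinset _).1 hwR).1, ?_⟩
    rw [wordValue_freeGroup_of, ← reduce.self (L := w), hwv, reduce.self]
  calc (numReturns s n : ℝ) = R.card := by
        rw [numReturns, Set.ncard_eq_toFinset_card _ (returns_finite s n)]
    _ = ∑ u ∈ R.image reduce, ((R.filter fun w => reduce w = u).card : ℝ) := by
        rw [Finset.card_eq_sum_card_image reduce R, Nat.cast_sum]
    _ ≤ ∑ u ∈ R.image reduce, (c + (2 * Fintype.card ι - 1) / c) ^ n * c⁻¹ ^ u.length :=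
        Finset.sum_le_sum hfibre
    _ ≤ _ := by
        rw [← Finset.mul_sum]
        refine mul_le_mul_of_nonneg_left
          (sum_comp_length_le_tsum (fun k => by positivity) hsum _ ?_) (pow_nonneg hμ n)
        intro u hu
        obtain ⟨w, hw, rfl⟩ := Finset.mem_image.1 hu
        exact reduce_mem_reducedReturns ((Set.Finite.mem_toFinset _).1 hw)

theorem rho_le_of_alpha_lt {s : ι → G} {c : ℝ} (hc : 1 ≤ c) (h : alpha s < c) :
    rho s ≤ c + (2 * Fintype.card ι - 1) / c := by
  have hc0 : 0 < c := by linarith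
  have hμ : 0 ≤ c + (2 * Fintype.card ι - 1) / c := by
    have hcard : (0 : ℝ) ≤ 2 * Fintype.card ι / c := by positivity
    have hinv : 1 / c ≤ c := ((div_le_one hc0).2 hc).trans hc
    rw [sub_div]
    linarith
  set C := ∑' k, numReducedReturns s k * c⁻¹ ^ k
  have hC : 0 ≤ C := tsum_nonneg fun k => by positivity
  refine growthRate_le (fun _ => Nat.cast_nonneg _) (add_pos_of_nonneg_of_pos hC one_pos) hμ
    fun n => ?_
  calc (numReturns s n : ℝ) ≤ (c + (2 * Fintype.card ι - 1) / c) ^ n * C :=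
        numReturns_le_mul_tsum hc hμ (summable_numReducedReturns_mul_inv_pow hc0 h) n
    _ ≤ (C + 1) * (c + (2 * Fintype.card ι - 1) / c) ^ n := by
        rw [mul_comm]
        gcongr
        linarith

theorem le_alpha_of_lt_rho {s : ι → G} {c : ℝ} (hc : 1 ≤ c)
    (h : c + (2 * Fintype.card ι - 1) / c < rho s) : c ≤ alpha s :=
  le_of_not_gt fun hlt => (rho_le_of_alpha_lt hc hlt).not_gt h

end FreeReduction

/-! ### Immersions into a Cayley graph -/

section SymmetricMatrix

open Matrix

variable {n : Type*} [Fintype n]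

theorem dotProduct_mulVec_self_le (B : Matrix n n ℝ) (f : n → ℝ) :
    (B *ᵥ f) ⬝ᵥ (B *ᵥ f) ≤ (B * Bᵀ).trace * (f ⬝ᵥ f) := by
  simp only [trace, diag_apply, mul_apply, transpose_apply, dotProduct, mulVec, ← sq,
    Finset.sum_mul]
  exact Finset.sum_le_sum fun i _ => by
    simpa only [Finset.sum_mul] using Finset.sum_mul_sq_le_sq_mul_sq Finset.univ (B i) f

variable {A : Matrix n n ℝ}

theorem dotProduct_mulVec_le_of_eigenvalue_le (hA : A.IsSymm) {r : ℝ}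
    (h : ∀ (μ : ℝ) (f : n → ℝ), f ≠ 0 → A *ᵥ f = μ • f → μ ≤ r) (f : n → ℝ) :
    f ⬝ᵥ A *ᵥ f ≤ r * (f ⬝ᵥ f) := by
  classical
  have hB : (r • (1 : Matrix n n ℝ) - A).IsHermitian := by
    rw [IsHermitian, conjTranspose_eq_transpose_of_trivial]
    simp [hA.eq]
  have hpos : (r • (1 : Matrix n n ℝ) - A).PosSemidef := by
    refine hB.posSemidef_iff_eigenvalues_nonneg.2 fun i => ?_
    have heigen := hB.mulVec_eigenvectorBasis i
    have hne : ⇑(hB.eigenvectorBasis i) ≠ 0 := fun h0 =>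
      hB.eigenvectorBasis.toBasis.ne_zero i (by ext j; simpa using congrFun h0 j)
    have hle : r - hB.eigenvalues i ≤ r := by
      refine h _ _ hne ?_
      rw [sub_mulVec, smul_mulVec, one_mulVec] at heigen
      rw [sub_smul, ← heigen, sub_sub_cancel]
    simpa using hle
  have hnonneg := hpos.dotProduct_mulVec_nonneg f
  rw [star_trivial, sub_mulVec, smul_mulVec, one_mulVec, dotProduct_sub, dotProduct_smul,
    smul_eq_mul] at hnonneg
  linarith

variable [DecidableEq n]

theorem pow_mulVec_eigenvector {μ : ℝ} {f : n → ℝ} (hf : A *ᵥ f = μ • f) (k : ℕ) :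
    (A ^ k) *ᵥ f = μ ^ k • f := by
  induction k with
  | zero => simp
  | succ k ih => rw [pow_succ, ← mulVec_mulVec, hf, mulVec_smul, ih, smul_smul, ← pow_succ']

theorem pow_eigenvalue_le_trace_pow (hA : A.IsSymm) {μ : ℝ} {f : n → ℝ} (hf0 : f ≠ 0)
    (hf : A *ᵥ f = μ • f) (k : ℕ) : μ ^ (2 * k) ≤ (A ^ (2 * k)).trace := by
  have hpos : 0 < f ⬝ᵥ f := by simpa using dotProduct_star_self_pos_iff.2 hf0
  have h := dotProduct_mulVec_self_le (A ^ k) f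
  rw [pow_mulVec_eigenvector hf, transpose_pow, hA.eq, ← pow_add, ← two_mul, smul_dotProduct,
    dotProduct_smul, smul_smul, ← pow_add, ← two_mul, smul_eq_mul] at h
  exact le_of_mul_le_mul_right h hpos

end SymmetricMatrix

/-- A finite graph whose edges are labelled by the generators `s`, mapped to the Cayley graph of
`(G, s)` by `value`, such that no two edges with the same label start, or end, at the same vertex.
A closed path in such a graph is determined by its starting point and its word, which represents
the identity. -/
structure CayleyImmersion {G ι : Type} [Group G] (s : ι → G) (V E : Type*) where
  verts : Finset V
  edges : Finset E
  label : E → ι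
  src : E → V
  tgt : E → V
  value : V → G
  src_mem : ∀ e ∈ edges, src e ∈ verts
  tgt_mem : ∀ e ∈ edges, tgt e ∈ verts
  value_tgt : ∀ e ∈ edges, value (tgt e) = value (src e) * s (label e)
  injOn_src : Set.InjOn (fun e => (label e, src e)) edges
  injOn_tgt : Set.InjOn (fun e => (label e, tgt e)) edges

theorem sum_card_filter_mul {V E : Type*} [DecidableEq V] {S : Finset V} {F : Finset E} {g : E → V}
    (hg : ∀ e ∈ F, g e ∈ S) (f : V → ℝ) :
    ∑ y : S, ((F.filter fun e => g e = y).card : ℝ) * f y = ∑ e ∈ F, f (g e) := by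
  rw [Finset.sum_coe_sort S fun y => ((F.filter fun e => g e = y).card : ℝ) * f y,
    ← Finset.sum_fiberwise_of_maps_to hg]
  refine Finset.sum_congr rfl fun y _ => ?_
  rw [Finset.sum_congr rfl fun e he => congrArg f (Finset.mem_filter.1 he).2, Finset.sum_const,
    nsmul_eq_mul]

namespace CayleyImmersion

open Matrix

variable {G ι : Type} [Group G] {s : ι → G} {V E : Type*} (Γ : CayleyImmersion s V E)

section AdjMatrix

variable [DecidableEq V]

/-- The adjacency matrix of the underlying undirected multigraph. -/
noncomputable def adjMatrix : Matrix Γ.verts Γ.verts ℝ := fun x y =>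
  (((Γ.edges.filter fun e => Γ.src e = x).filter fun e => Γ.tgt e = y).card : ℝ) +
    ((Γ.edges.filter fun e => Γ.tgt e = x).filter fun e => Γ.src e = y).card

theorem isSymm_adjMatrix : Γ.adjMatrix.IsSymm := by
  ext x y
  rw [transpose_apply, adjMatrix, adjMatrix, Finset.filter_comm, add_comm, Finset.filter_comm]

theorem adjMatrix_mulVec (f : V → ℝ) (x : Γ.verts) :
    (Γ.adjMatrix *ᵥ fun v => f v) x =
      ∑ e ∈ Γ.edges with Γ.src e = x, f (Γ.tgt e) +
        ∑ e ∈ Γ.edges with Γ.tgt e = x, f (Γ.src e) := by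
  simp only [mulVec, dotProduct, adjMatrix, add_mul, Finset.sum_add_distrib]
  rw [sum_card_filter_mul fun e he => Γ.tgt_mem e (Finset.mem_filter.1 he).1,
    sum_card_filter_mul fun e he => Γ.src_mem e (Finset.mem_filter.1 he).1]

theorem dotProduct_adjMatrix_mulVec (f : V → ℝ) :
    (fun v : Γ.verts => f v) ⬝ᵥ Γ.adjMatrix *ᵥ (fun v => f v) =
      2 * ∑ e ∈ Γ.edges, f (Γ.src e) * f (Γ.tgt e) := by
  have hfibre : ∀ {p q : E → V}, (∀ e ∈ Γ.edges, p e ∈ Γ.verts) →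
      ∑ v ∈ Γ.verts, f v * ∑ e ∈ Γ.edges with p e = v, f (q e) =
        ∑ e ∈ Γ.edges, f (p e) * f (q e) := by
    intro p q hp
    rw [← Finset.sum_fiberwise_of_maps_to hp]
    refine Finset.sum_congr rfl fun v _ => ?_
    rw [Finset.mul_sum]
    exact Finset.sum_congr rfl fun e he => by rw [(Finset.mem_filter.1 he).2]
  simp only [dotProduct, adjMatrix_mulVec, mul_add, Finset.sum_add_distrib]
  rw [Finset.sum_coe_sort Γ.verts fun v => f v * ∑ e ∈ Γ.edges with Γ.src e = v, f (Γ.tgt e),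
    Finset.sum_coe_sort Γ.verts fun v => f v * ∑ e ∈ Γ.edges with Γ.tgt e = v, f (Γ.src e),
    hfibre Γ.src_mem, hfibre Γ.tgt_mem, two_mul]
  simp only [mul_comm]

theorem sum_comp_label_le [Fintype ι] {p : E → V}
    (hp : Set.InjOn (fun e => (Γ.label e, p e)) Γ.edges) (x : V) {f : ι → ℝ} (hf : ∀ i, 0 ≤ f i) :
    ∑ e ∈ Γ.edges with p e = x, f (Γ.label e) ≤ ∑ i, f i := by
  classical
  have hinj : Set.InjOn Γ.label (Γ.edges.filter fun e => p e = x) := by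
    intro e he e' he' hlabel
    obtain ⟨he, hex⟩ := Finset.mem_filter.1 he
    obtain ⟨he', hex'⟩ := Finset.mem_filter.1 he'
    exact hp he he' (Prod.ext hlabel (hex.trans hex'.symm))
  rw [← Finset.sum_image (f := f) hinj]
  exact Finset.sum_le_univ_sum_of_nonneg hf

variable [Finite ι]

theorem adjMatrix_pow_le_numWords (n : ℕ) (x y : Γ.verts) :
    (Γ.adjMatrix ^ n) x y ≤ numWords s n ((Γ.value x)⁻¹ * Γ.value y) := by
  classical
  cases nonempty_fintype ι
  induction n generalizing x with
  | zero =>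
    rw [pow_zero, one_apply]
    split_ifs with hxy
    · simp [hxy, numWords_zero]
    · exact Nat.cast_nonneg _
  | succ n ih =>
    set g := (Γ.value x)⁻¹ * Γ.value y
    calc (Γ.adjMatrix ^ (n + 1)) x y = ∑ z, Γ.adjMatrix x z * (Γ.adjMatrix ^ n) z y := by
          rw [pow_succ', mul_apply]
      _ ≤ (Γ.adjMatrix *ᵥ fun z => (numWords s n ((Γ.value z)⁻¹ * Γ.value y) : ℝ)) x :=
          Finset.sum_le_sum fun z _ => mul_le_mul_of_nonneg_left (ih z) (by
            unfold adjMatrix; positivity)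
      _ = ∑ e ∈ Γ.edges with Γ.src e = x,
            (numWords s n ((letterValue s (Γ.label e, true))⁻¹ * g) : ℝ) +
          ∑ e ∈ Γ.edges with Γ.tgt e = x,
            (numWords s n ((letterValue s (Γ.label e, false))⁻¹ * g) : ℝ) := by
          rw [Γ.adjMatrix_mulVec fun z => (numWords s n ((Γ.value z)⁻¹ * Γ.value y) : ℝ)]
          congr 1 <;> refine Finset.sum_congr rfl fun e he => ?_ <;>
            obtain ⟨he, hex⟩ := Finset.mem_filter.1 he <;>
            simp [g, ← hex, Γ.value_tgt e he, letterValue, mul_assoc]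
      _ ≤ ∑ i, (numWords s n ((letterValue s (i, true))⁻¹ * g) : ℝ) +
          ∑ i, (numWords s n ((letterValue s (i, false))⁻¹ * g) : ℝ) :=
          add_le_add
            (Γ.sum_comp_label_le
              (f := fun i => (numWords s n ((letterValue s (i, true))⁻¹ * g) : ℝ))
              Γ.injOn_src x fun i => Nat.cast_nonneg _)
            (Γ.sum_comp_label_le
              (f := fun i => (numWords s n ((letterValue s (i, false))⁻¹ * g) : ℝ))
              Γ.injOn_tgt x fun i => Nat.cast_nonneg _)
      _ = numWords s (n + 1) g := by
          rw [numWords_succ, Nat.cast_sum, Fintype.sum_prod_type_right, Fintype.sum_bool]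

theorem trace_adjMatrix_pow_le (n : ℕ) :
    (Γ.adjMatrix ^ n).trace ≤ Γ.verts.card * numReturns s n := by
  calc (Γ.adjMatrix ^ n).trace ≤ ∑ _x : Γ.verts, (numReturns s n : ℝ) :=
        Finset.sum_le_sum fun x _ => by
          rw [diag_apply, ← numWords_one, ← inv_mul_cancel (Γ.value x)]
          exact Γ.adjMatrix_pow_le_numWords n x x
    _ = Γ.verts.card * numReturns s n := by simp

theorem eigenvalue_le_rho {μ : ℝ} {f : Γ.verts → ℝ} (hf0 : f ≠ 0)
    (hf : Γ.adjMatrix *ᵥ f = μ • f) : μ ≤ rho s := by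
  cases nonempty_fintype ι
  have hcard : 0 < (Γ.verts.card : ℝ) := by
    obtain ⟨x, -⟩ := Function.ne_iff.1 hf0
    exact Nat.cast_pos.2 (Finset.card_pos.2 ⟨x, x.2⟩)
  refine (le_abs_self μ).trans (le_growthRate_of_frequently (fun _ => Nat.cast_nonneg _)
    (by positivity) (numReturns_cast_le s) (inv_pos.2 hcard) (abs_nonneg μ) ?_)
  refine frequently_atTop.2 fun n => ⟨2 * n, by omega, ?_⟩
  rw [inv_mul_le_iff₀ hcard, (even_two_mul n).pow_abs]
  exact (pow_eigenvalue_le_trace_pow Γ.isSymm_adjMatrix hf0 hf n).trans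
    (Γ.trace_adjMatrix_pow_le (2 * n))

end AdjMatrix

theorem two_mul_sum_edges_le [Finite ι] (f : V → ℝ) :
    2 * ∑ e ∈ Γ.edges, f (Γ.src e) * f (Γ.tgt e) ≤ rho s * ∑ v ∈ Γ.verts, f v ^ 2 := by
  classical
  rw [← Γ.dotProduct_adjMatrix_mulVec]
  refine (dotProduct_mulVec_le_of_eigenvalue_le Γ.isSymm_adjMatrix
    (fun _ _ => Γ.eigenvalue_le_rho) _).trans_eq ?_
  rw [dotProduct, Finset.sum_coe_sort Γ.verts fun v => f v * f v]
  simp only [sq]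

end CayleyImmersion

/-! ### Thompson's group -/

open BinaryTree
open scoped BinaryTree commutatorElement

section ForestElement

variable {G : Type*} [Group G]

/-- The element of `G` represented by the forest diagram that builds the tree `t` from leaves: a
caret is `b⁻¹`, and conjugation by `a` moves a diagram one place to the right. -/
def treeElement (a b : G) : BinaryTree Unit → G
  | nil => 1
  | node _ t u => treeElement a b t * (a⁻¹ * treeElement a b u * a) * b⁻¹

/-- The element of `G` that builds the trees to the left of the pointer of a forest diagram, the
nearest tree being the head of the list. -/
def leftForest (a b : G) : List (BinaryTree Unit) → G
  | [] => 1
  | t :: L => leftForest a b L * treeElement a b t * a⁻¹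

/-- The element of `G` that builds the trees to the right of the pointer of a forest diagram, the
head of the list being the tree at the pointer. -/
def rightForest (a b : G) : List (BinaryTree Unit) → G
  | [] => 1
  | t :: R => treeElement a b t * (a⁻¹ * rightForest a b R * a)

/-- The elements all of whose conjugates by positive powers of `a` commute with `a * b⁻¹`. That
`b` belongs to this subgroup expresses the infinite presentation of Thompson's group. -/
def shiftCommuting (a b : G) : Subgroup G :=
  ⨅ j : ℕ, (Subgroup.centralizer {a * b⁻¹}).comap (MulAut.conj (a ^ (j + 1))⁻¹).toMonoidHom

variable {a b : G}

theorem mem_shiftCommuting {g : G} : g ∈ shiftCommuting a b ↔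
    ∀ j : ℕ, Commute (a * b⁻¹) ((a ^ (j + 1))⁻¹ * g * a ^ (j + 1)) := by
  simp only [shiftCommuting, Subgroup.mem_iInf, Subgroup.mem_comap,
    Subgroup.mem_centralizer_singleton_iff, MulEquiv.coe_toMonoidHom, MulAut.conj_apply, inv_inv,
    commute_iff_eq, eq_comm]

theorem conj_mem_shiftCommuting {g : G} (hg : g ∈ shiftCommuting a b) :
    a⁻¹ * g * a ∈ shiftCommuting a b := by
  refine mem_shiftCommuting.2 fun j => ?_
  convert mem_shiftCommuting.1 hg (j + 1) using 1
  rw [pow_succ a (j + 1), pow_succ' a]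
  group

-- Write `b_j` for the conjugate of `b` by `a ^ j`. By the first relation `b_2` is the conjugate of
-- `b_1` by `b`, hence `b_(j + 2)` is that of `b_(j + 1)` by `b_j`.
theorem mem_shiftCommuting_of_commute (h₁ : Commute (a * b⁻¹) (a⁻¹ * b * a))
    (h₂ : Commute (a * b⁻¹) ((a ^ 2)⁻¹ * b * a ^ 2)) : b ∈ shiftCommuting a b := by
  have hconj : (a ^ 2)⁻¹ * b * a ^ 2 = b⁻¹ * (a⁻¹ * b * a) * b := by
    calc (a ^ 2)⁻¹ * b * a ^ 2 = a⁻¹ * ((a⁻¹ * b * a) * (a * b⁻¹)) * b := by rw [sq]; group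
      _ = b⁻¹ * (a⁻¹ * b * a) * b := by rw [← h₁.eq]; group
  have hrec : ∀ j : ℕ, (a ^ (j + 2))⁻¹ * b * a ^ (j + 2) =
      ((a ^ j)⁻¹ * b * a ^ j)⁻¹ * ((a ^ (j + 1))⁻¹ * b * a ^ (j + 1)) *
        ((a ^ j)⁻¹ * b * a ^ j) := by
    intro j
    calc (a ^ (j + 2))⁻¹ * b * a ^ (j + 2) = (a ^ j)⁻¹ * ((a ^ 2)⁻¹ * b * a ^ 2) * a ^ j := by
          rw [add_comm j 2, pow_add]; group
      _ = _ := by rw [hconj, add_comm j 1, pow_add]; group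
  have hpair : ∀ j : ℕ, Commute (a * b⁻¹) ((a ^ (j + 1))⁻¹ * b * a ^ (j + 1)) ∧
      Commute (a * b⁻¹) ((a ^ (j + 2))⁻¹ * b * a ^ (j + 2)) := by
    intro j
    induction j with
    | zero => exact ⟨by simpa using h₁, h₂⟩
    | succ j ih =>
      refine ⟨ih.2, ?_⟩
      rw [hrec (j + 1)]
      exact (ih.1.inv_right.mul_right ih.2).mul_right ih.1
  exact mem_shiftCommuting.2 fun j => (hpair j).1

theorem treeElement_mem_shiftCommuting (hb : b ∈ shiftCommuting a b) (t : BinaryTree Unit) :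
    treeElement a b t ∈ shiftCommuting a b := by
  induction t with
  | nil => exact one_mem _
  | node _ t u iht ihu =>
    exact mul_mem (mul_mem iht (conj_mem_shiftCommuting ihu)) (inv_mem hb)

theorem rightForest_mem_shiftCommuting (hb : b ∈ shiftCommuting a b)
    (R : List (BinaryTree Unit)) : rightForest a b R ∈ shiftCommuting a b := by
  induction R with
  | nil => exact one_mem _
  | cons t R ih =>
    exact mul_mem (treeElement_mem_shiftCommuting hb t) (conj_mem_shiftCommuting ih)

theorem leftForest_mul_rightForest_cons (L R : List (BinaryTree Unit)) (t : BinaryTree Unit) :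
    leftForest a b L * rightForest a b (t :: R) =
      leftForest a b (t :: L) * rightForest a b R * a := by
  simp only [leftForest, rightForest]
  group

theorem rightForest_cons_cons (hb : b ∈ shiftCommuting a b) (R : List (BinaryTree Unit))
    (t u : BinaryTree Unit) :
    rightForest a b (t :: u :: R) = rightForest a b ((t △ u) :: R) * b := by
  have hcomm : Commute (a * b⁻¹) (a⁻¹ * rightForest a b R * a) := by
    simpa using mem_shiftCommuting.1 (rightForest_mem_shiftCommuting hb R) 0
  calc rightForest a b (t :: u :: R)
      = treeElement a b t * a⁻¹ * treeElement a b u *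
          ((a⁻¹ * rightForest a b R * a) * (a * b⁻¹)) * b := by
        simp only [rightForest]; group
    _ = rightForest a b ((t △ u) :: R) * b := by
        rw [← hcomm.eq]; simp only [rightForest, treeElement]; group

end ForestElement

section ListsOfLengthLT

variable {α : Type*} [DecidableEq α] {T : Finset α}

/-- The lists of length less than `n` with entries in `T`. -/
def listsOfLengthLT (T : Finset α) : ℕ → Finset (List α)
  | 0 => ∅
  | n + 1 => insert [] ((T ×ˢ listsOfLengthLT T n).image fun p => p.1 :: p.2)

theorem cons_mem_listsOfLengthLT {n : ℕ} {t : α} {L : List α} :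
    t :: L ∈ listsOfLengthLT T (n + 1) ↔ t ∈ T ∧ L ∈ listsOfLengthLT T n := by
  simp [listsOfLengthLT]

theorem listsOfLengthLT_subset_succ (n : ℕ) :
    listsOfLengthLT T n ⊆ listsOfLengthLT T (n + 1) := by
  intro L hL
  induction n generalizing L with
  | zero => exact absurd hL (Finset.notMem_empty L)
  | succ n ih =>
    rcases L with _ | ⟨t, L⟩
    · exact Finset.mem_insert_self _ _
    · rw [cons_mem_listsOfLengthLT] at hL ⊢
      exact ⟨hL.1, ih hL.2⟩

theorem sum_listsOfLengthLT_sq_prod {ψ : α → ℝ} (hψ : ∑ t ∈ T, ψ t ^ 2 = 1) (n : ℕ) :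
    ∑ L ∈ listsOfLengthLT T n, (L.map ψ).prod ^ 2 = n := by
  induction n with
  | zero => simp [listsOfLengthLT]
  | succ n ih =>
    rw [listsOfLengthLT, Finset.sum_insert (by simp),
      Finset.sum_image fun p _ q _ h => Prod.ext (List.cons.inj h).1 (List.cons.inj h).2,
      Finset.sum_product]
    simp only [List.map_nil, List.prod_nil, List.map_cons, List.prod_cons, mul_pow,
      ← Finset.mul_sum, ← Finset.sum_mul, hψ, ih]
    push_cast
    ring

end ListsOfLengthLT

section ForestImmersion

variable {G : Type} [Group G] {s : Fin 2 → G}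

/-- Forest diagrams with fewer than `n + 2` trees from `T` on each side of the pointer. An edge
labelled `a` moves the pointer across a tree, one labelled `b` removes the top caret of the tree
at the pointer; carets are only removed when they join a pair of trees in `P`. -/
def forestImmersion (hs : s 1 ∈ shiftCommuting (s 0) (s 1)) {T : Finset (BinaryTree Unit)}
    {P : Finset (BinaryTree Unit × BinaryTree Unit)}
    (hP : ∀ p ∈ P, p.1 ∈ T ∧ p.2 ∈ T ∧ p.1 △ p.2 ∈ T) (n : ℕ) :
    CayleyImmersion s (List (BinaryTree Unit) × List (BinaryTree Unit))
      (BinaryTree Unit × List (BinaryTree Unit) × List (BinaryTree Unit) ⊕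
        (BinaryTree Unit × BinaryTree Unit) × List (BinaryTree Unit) × List (BinaryTree Unit)) where
  verts := listsOfLengthLT T (n + 2) ×ˢ listsOfLengthLT T (n + 2)
  edges := (T ×ˢ listsOfLengthLT T (n + 1) ×ˢ listsOfLengthLT T (n + 1)).disjSum
    (P ×ˢ listsOfLengthLT T (n + 2) ×ˢ listsOfLengthLT T n)
  label := Sum.elim (fun _ => 0) fun _ => 1
  src := Sum.elim (fun e => (e.1 :: e.2.1, e.2.2)) fun e => (e.2.1, (e.1.1 △ e.1.2) :: e.2.2)
  tgt := Sum.elim (fun e => (e.2.1, e.1 :: e.2.2)) fun e => (e.2.1, e.1.1 :: e.1.2 :: e.2.2)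
  value v := leftForest (s 0) (s 1) v.1 * rightForest (s 0) (s 1) v.2
  src_mem := by
    rintro (⟨t, L, R⟩ | ⟨⟨t, u⟩, L, R⟩) he <;>
      simp only [Finset.inl_mem_disjSum, Finset.inr_mem_disjSum, Finset.mem_product] at he <;>
      refine Finset.mem_product.2 ?_
    · exact ⟨cons_mem_listsOfLengthLT.2 ⟨he.1, he.2.1⟩, listsOfLengthLT_subset_succ _ he.2.2⟩
    · exact ⟨he.2.1, cons_mem_listsOfLengthLT.2
        ⟨(hP _ he.1).2.2, listsOfLengthLT_subset_succ _ he.2.2⟩⟩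
  tgt_mem := by
    rintro (⟨t, L, R⟩ | ⟨⟨t, u⟩, L, R⟩) he <;>
      simp only [Finset.inl_mem_disjSum, Finset.inr_mem_disjSum, Finset.mem_product] at he <;>
      refine Finset.mem_product.2 ?_
    · exact ⟨listsOfLengthLT_subset_succ _ he.2.1, cons_mem_listsOfLengthLT.2 ⟨he.1, he.2.2⟩⟩
    · exact ⟨he.2.1, cons_mem_listsOfLengthLT.2
        ⟨(hP _ he.1).1, cons_mem_listsOfLengthLT.2 ⟨(hP _ he.1).2.1, he.2.2⟩⟩⟩
  value_tgt := by
    rintro (⟨t, L, R⟩ | ⟨⟨t, u⟩, L, R⟩) -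
    · exact leftForest_mul_rightForest_cons L R t
    · exact (congrArg _ (rightForest_cons_cons hs R t u)).trans (mul_assoc _ _ _).symm
  injOn_src := by
    refine Function.Injective.injOn ?_
    rintro (⟨t, L, R⟩ | ⟨⟨t, u⟩, L, R⟩) (⟨t', L', R'⟩ | ⟨⟨t', u'⟩, L', R'⟩) h <;> simp_all
  injOn_tgt := by
    refine Function.Injective.injOn ?_
    rintro (⟨t, L, R⟩ | ⟨⟨t, u⟩, L, R⟩) (⟨t', L', R'⟩ | ⟨⟨t', u'⟩, L', R'⟩) h <;> simp_all

variable {T : Finset (BinaryTree Unit)} {P : Finset (BinaryTree Unit × BinaryTree Unit)}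
  {ψ : BinaryTree Unit → ℝ}

theorem sum_pairs_of_lists_sq_prod (hψ : ∑ t ∈ T, ψ t ^ 2 = 1) (m n : ℕ) :
    ∑ v ∈ listsOfLengthLT T m ×ˢ listsOfLengthLT T n,
      ((v.1.map ψ).prod * (v.2.map ψ).prod) ^ 2 = m * n := by
  simp only [mul_pow, Finset.sum_product]
  rw [← Finset.sum_mul_sum, sum_listsOfLengthLT_sq_prod hψ, sum_listsOfLengthLT_sq_prod hψ]

theorem sum_mul_pairs_of_lists_sq_prod {α : Type*} (hψ : ∑ t ∈ T, ψ t ^ 2 = 1) (A : Finset α)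
    (g : α → ℝ) (m n : ℕ) :
    ∑ e ∈ A ×ˢ listsOfLengthLT T m ×ˢ listsOfLengthLT T n,
      g e.1 * ((e.2.1.map ψ).prod * (e.2.2.map ψ).prod) ^ 2 = (∑ x ∈ A, g x) * (m * n) := by
  rw [Finset.sum_product, ← sum_pairs_of_lists_sq_prod hψ m n, Finset.sum_mul_sum]

theorem sum_edges_forestImmersion (hs : s 1 ∈ shiftCommuting (s 0) (s 1))
    (hP : ∀ p ∈ P, p.1 ∈ T ∧ p.2 ∈ T ∧ p.1 △ p.2 ∈ T) (hψ : ∑ t ∈ T, ψ t ^ 2 = 1) (n : ℕ) :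
    ∑ e ∈ (forestImmersion hs hP n).edges,
      (((forestImmersion hs hP n).src e).1.map ψ).prod *
        (((forestImmersion hs hP n).src e).2.map ψ).prod *
      ((((forestImmersion hs hP n).tgt e).1.map ψ).prod *
        (((forestImmersion hs hP n).tgt e).2.map ψ).prod) =
      (n + 1) ^ 2 + (n + 2) * n * ∑ p ∈ P, ψ p.1 * ψ p.2 * ψ (p.1 △ p.2) := by
  have ha := sum_mul_pairs_of_lists_sq_prod hψ T (fun t => ψ t ^ 2) (n + 1) (n + 1)
  have hb := sum_mul_pairs_of_lists_sq_prod hψ P (fun p => ψ p.1 * ψ p.2 * ψ (p.1 △ p.2)) (n + 2) n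
  rw [hψ] at ha
  push_cast at ha hb
  rw [sq ((n : ℝ) + 1), ← one_mul (((n : ℝ) + 1) * (n + 1)), ← ha, mul_comm (((n : ℝ) + 2) * n),
    ← hb]
  simp only [forestImmersion, Finset.sum_disjSum, Sum.elim_inl, Sum.elim_inr, List.map_cons,
    List.prod_cons]
  congr 1 <;> refine Finset.sum_congr rfl fun e _ => ?_ <;> ring

theorem forestImmersion_rayleigh (hs : s 1 ∈ shiftCommuting (s 0) (s 1))
    (hP : ∀ p ∈ P, p.1 ∈ T ∧ p.2 ∈ T ∧ p.1 △ p.2 ∈ T) (hψ : ∑ t ∈ T, ψ t ^ 2 = 1) (n : ℕ) :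
    2 * ((n + 1) ^ 2 + (n + 2) * n * ∑ p ∈ P, ψ p.1 * ψ p.2 * ψ (p.1 △ p.2)) ≤
      rho s * ((n + 2) * (n + 2)) := by
  have hverts := sum_pairs_of_lists_sq_prod hψ (n + 2) (n + 2)
  push_cast at hverts
  rw [← sum_edges_forestImmersion hs hP hψ, ← hverts]
  exact (forestImmersion hs hP n).two_mul_sum_edges_le
    fun v => (v.1.map ψ).prod * (v.2.map ψ).prod

theorem two_add_two_mul_sum_le_rho (hs : s 1 ∈ shiftCommuting (s 0) (s 1))
    (hP : ∀ p ∈ P, p.1 ∈ T ∧ p.2 ∈ T ∧ p.1 △ p.2 ∈ T) (hψ : ∑ t ∈ T, ψ t ^ 2 = 1) :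
    2 + 2 * ∑ p ∈ P, ψ p.1 * ψ p.2 * ψ (p.1 △ p.2) ≤ rho s := by
  refine sub_nonpos.1 (nonpos_of_forall_nat_mul_le (C := 2 * rho s) fun n => ?_)
  have hn : (0 : ℝ) < n + 2 := by positivity
  refine le_of_mul_le_mul_left ?_ hn
  linarith [forestImmersion_rayleigh hs hP hψ n]

end ForestImmersion

/-- The binary trees of height less than `h`. -/
def treesOfHeightLT : ℕ → Finset (BinaryTree Unit)
  | 0 => ∅
  | h + 1 => insert nil ((treesOfHeightLT h ×ˢ treesOfHeightLT h).image fun p => p.1 △ p.2)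

theorem mem_treesOfHeightLT {h : ℕ} {t : BinaryTree Unit} :
    t ∈ treesOfHeightLT h ↔ t.height < h := by
  induction h generalizing t with
  | zero => simp [treesOfHeightLT]
  | succ h ih => cases t <;> simp [treesOfHeightLT, BinaryTree.height, ih]

theorem sum_treesOfHeightLT_succ (g : BinaryTree Unit → ℝ) (h : ℕ) :
    ∑ t ∈ treesOfHeightLT (h + 1), g t =
      g nil + ∑ p ∈ treesOfHeightLT h ×ˢ treesOfHeightLT h, g (p.1 △ p.2) := by
  rw [treesOfHeightLT, Finset.sum_insert (by simp), Finset.sum_image]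
  rintro p - q - hpq
  exact Prod.ext (node.inj hpq).2.1 (node.inj hpq).2.2

theorem sum_treePairs_max_height (w : ℕ → ℝ) (g : BinaryTree Unit → ℝ) (h : ℕ) :
    ∑ p ∈ treesOfHeightLT h ×ˢ treesOfHeightLT h,
      w (max p.1.height p.2.height) * (g p.1 * g p.2) =
      ∑ k ∈ Finset.range h, w k * ((∑ t ∈ treesOfHeightLT (k + 1), g t) ^ 2 -
        (∑ t ∈ treesOfHeightLT k, g t) ^ 2) := by
  induction h with
  | zero => simp [treesOfHeightLT]
  | succ h ih =>
    have hsub : treesOfHeightLT h ×ˢ treesOfHeightLT h ⊆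
        treesOfHeightLT (h + 1) ×ˢ treesOfHeightLT (h + 1) := by
      intro p hp
      simp only [Finset.mem_product, mem_treesOfHeightLT] at hp ⊢
      omega
    have hmax : ∀ p ∈ (treesOfHeightLT (h + 1) ×ˢ treesOfHeightLT (h + 1)) \
        (treesOfHeightLT h ×ˢ treesOfHeightLT h), max p.1.height p.2.height = h := by
      intro p hp
      simp only [Finset.mem_sdiff, Finset.mem_product, mem_treesOfHeightLT] at hp
      omega
    have hsq : ∀ k, (∑ t ∈ treesOfHeightLT k, g t) ^ 2 =
        ∑ p ∈ treesOfHeightLT k ×ˢ treesOfHeightLT k, g p.1 * g p.2 := fun k => by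
      rw [sq, Finset.sum_mul_sum, Finset.sum_product]
    rw [← Finset.sum_sdiff hsub, ih, Finset.sum_range_succ, add_comm, hsq, hsq,
      ← Finset.sum_sdiff hsub, add_sub_cancel_right, Finset.mul_sum]
    congr 1
    exact Finset.sum_congr rfl fun p hp => by rw [hmax p hp]

/-- Weights on binary trees for which the trees of height less than `h` have total squared weight
`m h`. The coefficient of a node is constant among the trees of a given height. -/
noncomputable def treeWeight (m : ℕ → ℝ) : BinaryTree Unit → ℝ
  | nil => √(m 1)
  | node _ t u =>
    √((m (max t.height u.height + 2) - m (max t.height u.height + 1)) /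
      (m (max t.height u.height + 1) ^ 2 - m (max t.height u.height) ^ 2)) *
      (treeWeight m t * treeWeight m u)

section TreeWeight

variable {m : ℕ → ℝ}

theorem sq_sub_sq_succ_pos (hm : StrictMono m) (hm0 : m 0 = 0) (k : ℕ) :
    0 < m (k + 1) ^ 2 - m k ^ 2 := by
  have h0 : 0 ≤ m k := hm0.symm.trans_le (hm.monotone (Nat.zero_le k))
  exact sub_pos.2 (pow_lt_pow_left₀ (hm (Nat.lt_succ_self k)) h0 two_ne_zero)

theorem sum_treeWeight_sq (hm : StrictMono m) (hm0 : m 0 = 0) (h : ℕ) :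
    ∑ t ∈ treesOfHeightLT h, treeWeight m t ^ 2 = m h := by
  induction h using Nat.strong_induction_on with
  | _ h ih =>
    rcases h with _ | h
    · simp [treesOfHeightLT, hm0]
    · have hinc : ∀ k, 0 ≤ m (k + 2) - m (k + 1) := fun k =>
        sub_nonneg.2 (hm.monotone (Nat.le_succ _))
      have hpairs := sum_treePairs_max_height
        (fun k => (m (k + 2) - m (k + 1)) / (m (k + 1) ^ 2 - m k ^ 2))
        (fun t => treeWeight m t ^ 2) h
      have hterm : ∀ k ∈ Finset.range h, (m (k + 2) - m (k + 1)) / (m (k + 1) ^ 2 - m k ^ 2) *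
          ((∑ t ∈ treesOfHeightLT (k + 1), treeWeight m t ^ 2) ^ 2 -
            (∑ t ∈ treesOfHeightLT k, treeWeight m t ^ 2) ^ 2) = m (k + 2) - m (k + 1) := by
        intro k hk
        rw [Finset.mem_range] at hk
        rw [ih (k + 1) (by omega), ih k (by omega),
          div_mul_cancel₀ _ (sq_sub_sq_succ_pos hm hm0 k).ne']
      rw [Finset.sum_congr rfl hterm, Finset.sum_range_sub fun k => m (k + 1)] at hpairs
      have hm1 : 0 ≤ m 1 := hm0.symm.trans_le (hm.monotone zero_le_one)
      simp only [sum_treesOfHeightLT_succ, treeWeight, mul_pow, Real.sq_sqrt hm1,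
        Real.sq_sqrt (div_nonneg (hinc _) (sq_sub_sq_succ_pos hm hm0 _).le), hpairs]
      ring

theorem sum_treeWeight_mul_treeWeight_node (hm : StrictMono m) (hm0 : m 0 = 0) (h : ℕ) :
    ∑ p ∈ treesOfHeightLT h ×ˢ treesOfHeightLT h,
      treeWeight m p.1 * treeWeight m p.2 * treeWeight m (p.1 △ p.2) =
      ∑ k ∈ Finset.range h, √((m (k + 2) - m (k + 1)) * (m (k + 1) ^ 2 - m k ^ 2)) := by
  calc _ = ∑ p ∈ treesOfHeightLT h ×ˢ treesOfHeightLT h,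
        √((m (max p.1.height p.2.height + 2) - m (max p.1.height p.2.height + 1)) /
          (m (max p.1.height p.2.height + 1) ^ 2 - m (max p.1.height p.2.height) ^ 2)) *
          (treeWeight m p.1 ^ 2 * treeWeight m p.2 ^ 2) :=
        Finset.sum_congr rfl fun p _ => by rw [treeWeight]; ring
    _ = _ := by
      rw [sum_treePairs_max_height
        (fun k => √((m (k + 2) - m (k + 1)) / (m (k + 1) ^ 2 - m k ^ 2)))
        (fun t => treeWeight m t ^ 2)]
      refine Finset.sum_congr rfl fun k _ => ?_
      have hinc : 0 ≤ m (k + 2) - m (k + 1) := sub_nonneg.2 (hm.monotone (Nat.le_succ _))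
      rw [sum_treeWeight_sq hm hm0, sum_treeWeight_sq hm hm0, Real.sqrt_div hinc,
        Real.sqrt_mul hinc, div_mul_eq_mul_div, mul_div_assoc, Real.div_sqrt]

theorem two_add_two_mul_sum_sqrt_le_rho {G : Type} [Group G] {s : Fin 2 → G}
    (hs : s 1 ∈ shiftCommuting (s 0) (s 1)) (hm : StrictMono m) (hm0 : m 0 = 0) {n : ℕ}
    (hmn : m (n + 1) = 1) :
    2 + 2 * ∑ k ∈ Finset.range n, √((m (k + 2) - m (k + 1)) * (m (k + 1) ^ 2 - m k ^ 2)) ≤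
      rho s := by
  rw [← sum_treeWeight_mul_treeWeight_node hm hm0]
  refine two_add_two_mul_sum_le_rho hs (fun p hp => ?_) ((sum_treeWeight_sq hm hm0 _).trans hmn)
  simp only [Finset.mem_product, mem_treesOfHeightLT, BinaryTree.height] at hp ⊢
  omega

end TreeWeight

theorem thompsonGen_mem_shiftCommuting :
    thompsonGen 1 ∈ shiftCommuting (thompsonGen 0) (thompsonGen 1) := by
  have hcomm : ∀ x y : FreeGroup (Fin 2), ⁅x, y⁆ ∈ ({⁅fa * fb⁻¹, fa⁻¹ * fb * fa⁆,
      ⁅fa * fb⁻¹, (fa ^ 2)⁻¹ * fb * fa ^ 2⁆} : Set (FreeGroup (Fin 2))) →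
      Commute (PresentedGroup.mk {⁅fa * fb⁻¹, fa⁻¹ * fb * fa⁆,
        ⁅fa * fb⁻¹, (fa ^ 2)⁻¹ * fb * fa ^ 2⁆} x) (PresentedGroup.mk _ y) := by
    intro x y h
    rw [← commutatorElement_eq_one_iff_commute, ← map_commutatorElement]
    exact PresentedGroup.one_of_mem h
  exact mem_shiftCommuting_of_commute (hcomm _ _ (Or.inl rfl)) (hcomm _ _ (Or.inr rfl))

/-- The squared weight given to the trees of height less than `h` in Thompson's group. It takes
the value `1` at `h = 9`; the truncated subtraction makes it vanish at `h = 0`. -/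
noncomputable def thompsonProfile (h : ℕ) : ℝ := (2 * h - 1 : ℕ) / 17

theorem strictMono_thompsonProfile : StrictMono thompsonProfile := by
  refine strictMono_nat_of_lt_succ fun h => ?_
  exact div_lt_div_of_pos_right (Nat.cast_lt.2 (by omega)) (by norm_num)

theorem le_rho_thompsonGen : 3.57 ≤ rho thompsonGen := by
  refine le_trans ?_ (two_add_two_mul_sum_sqrt_le_rho thompsonGen_mem_shiftCommuting
    strictMono_thompsonProfile (by simp [thompsonProfile])
    (show thompsonProfile (8 + 1) = 1 by norm_num [thompsonProfile]))
  have hterms : ∀ k : Fin 8, ![0.02, 0.057, 0.08, 0.098, 0.114, 0.127, 0.139, 0.15] k ≤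
      √((thompsonProfile (k + 2) - thompsonProfile (k + 1)) *
        (thompsonProfile (k + 1) ^ 2 - thompsonProfile k ^ 2)) := by
    intro k
    refine Real.le_sqrt_of_sq_le ?_
    fin_cases k <;> norm_num [thompsonProfile]
  have hsum := Finset.sum_le_sum fun k (_ : k ∈ Finset.univ) => hterms k
  rw [Fin.sum_univ_eq_sum_range (fun k => √((thompsonProfile (k + 2) - thompsonProfile (k + 1)) *
    (thompsonProfile (k + 1) ^ 2 - thompsonProfile k ^ 2)))] at hsum
  refine le_trans ?_ (add_le_add_right (mul_le_mul_of_nonneg_left hsum zero_le_two) 2)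
  norm_num [Fin.sum_univ_succ]

/-! ### Baumslag–Solitar groups -/

/-- A syllable `(ε, r)` stands for `a ^ r * b` or `a ^ r * b⁻¹`, according to the sign `ε`. -/
abbrev Syllable : Type := Bool × ℕ

/-- The sign of the last syllable; syllable lists have their last syllable at the head. -/
def lastSign : List Syllable → Bool
  | [] => true
  | σ :: _ => σ.1

/-- The syllables that may follow a syllable of sign `τ` in a reduced sequence, where the exponent
before `b` is taken modulo `d true` and the exponent before `b⁻¹` modulo `d false`. -/
def nextSyllables (d : Bool → ℕ) (τ : Bool) : Finset Syllable :=
  (Finset.range (d τ)).image (Prod.mk τ) ∪ (Finset.Ico 1 (d (!τ))).image (Prod.mk (!τ))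

/-- The reduced sequences of `k` syllables. -/
def reducedSyllables (d : Bool → ℕ) : ℕ → Finset (List Syllable)
  | 0 => {[]}
  | k + 1 => ((reducedSyllables d k).sigma fun l => nextSyllables d (lastSign l)).image
      fun x => x.2 :: x.1

/-- The reduced sequences of fewer than `n` syllables. -/
def reducedSyllablesLT (d : Bool → ℕ) (n : ℕ) : Finset (List Syllable) :=
  (Finset.range n).biUnion (reducedSyllables d)

section ReducedSyllables

variable {d : Bool → ℕ}

theorem mem_nextSyllables {τ : Bool} {σ : Syllable} :
    σ ∈ nextSyllables d τ ↔ σ.2 < d σ.1 ∧ (σ.1 ≠ τ → 0 < σ.2) := by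
  obtain ⟨ε, r⟩ := σ
  cases ε <;> cases τ <;>
    simp [nextSyllables, Nat.one_le_iff_ne_zero, Nat.pos_iff_ne_zero, and_comm]

theorem sum_nextSyllables (τ : Bool) (F : Syllable → ℝ) : ∑ σ ∈ nextSyllables d τ, F σ =
    ∑ r ∈ Finset.range (d τ), F (τ, r) + ∑ r ∈ Finset.Ico 1 (d (!τ)), F (!τ, r) := by
  rw [nextSyllables, Finset.sum_union, Finset.sum_image (Prod.mk_right_injective τ).injOn,
    Finset.sum_image (Prod.mk_right_injective (!τ)).injOn]
  simp only [Finset.disjoint_left, Finset.mem_image]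
  rintro _ ⟨r, -, rfl⟩ ⟨r', -, h⟩
  exact Bool.not_ne_self τ (congrArg Prod.fst h)

theorem length_of_mem_reducedSyllables {k : ℕ} {l : List Syllable}
    (hl : l ∈ reducedSyllables d k) : l.length = k := by
  induction k generalizing l with
  | zero => simpa [reducedSyllables] using hl
  | succ k ih =>
    obtain ⟨⟨l', σ⟩, hx, rfl⟩ := Finset.mem_image.1 hl
    exact congrArg (· + 1) (ih (Finset.mem_sigma.1 hx).1)

theorem sum_reducedSyllables_succ (k : ℕ) (F : List Syllable → ℝ) :
    ∑ l ∈ reducedSyllables d (k + 1), F l =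
      ∑ l ∈ reducedSyllables d k, ∑ σ ∈ nextSyllables d (lastSign l), F (σ :: l) := by
  rw [reducedSyllables, Finset.sum_image, Finset.sum_sigma]
  rintro ⟨l, σ⟩ _ ⟨l', σ'⟩ _ h
  obtain ⟨rfl, rfl⟩ := List.cons.inj h
  rfl

theorem sum_reducedSyllablesLT (n : ℕ) (F : List Syllable → ℝ) :
    ∑ l ∈ reducedSyllablesLT d n, F l =
      ∑ k ∈ Finset.range n, ∑ l ∈ reducedSyllables d k, F l := by
  refine Finset.sum_biUnion fun i _ j _ hij => ?_
  rw [Function.onFun, Finset.disjoint_left]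
  exact fun l hi hj =>
    hij ((length_of_mem_reducedSyllables hi).symm.trans (length_of_mem_reducedSyllables hj))

theorem length_lt_of_mem_reducedSyllablesLT {n : ℕ} {l : List Syllable}
    (hl : l ∈ reducedSyllablesLT d n) : l.length < n := by
  obtain ⟨k, hk, hl⟩ := Finset.mem_biUnion.1 hl
  exact (length_of_mem_reducedSyllables hl).trans_lt (Finset.mem_range.1 hk)

theorem reducedSyllablesLT_subset_succ (n : ℕ) :
    reducedSyllablesLT d n ⊆ reducedSyllablesLT d (n + 1) :=
  Finset.biUnion_subset_biUnion_of_subset_left _ (Finset.range_subset_range.2 n.le_succ)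

theorem cons_mem_reducedSyllablesLT {n : ℕ} {l : List Syllable} {σ : Syllable}
    (hl : l ∈ reducedSyllablesLT d n) (hσ : σ ∈ nextSyllables d (lastSign l)) :
    σ :: l ∈ reducedSyllablesLT d (n + 1) := by
  obtain ⟨k, hk, hl⟩ := Finset.mem_biUnion.1 hl
  exact Finset.mem_biUnion.2 ⟨k + 1, Finset.mem_range.2 (by simpa using hk),
    Finset.mem_image.2 ⟨⟨l, σ⟩, Finset.mem_sigma.2 ⟨hl, hσ⟩, rfl⟩⟩

theorem mul_not_eq (d : Bool → ℕ) (ε : Bool) : d ε * d (!ε) = d true * d false := by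
  cases ε
  · exact mul_comm _ _
  · rfl

end ReducedSyllables

/-- The number of periods, of `d true * d false` positions each, in the segment of the `a`-line
over a sequence of at most `D` syllables. -/
def numPeriods (d : Bool → ℕ) (D : ℕ) (l : List Syllable) : ℕ :=
  (D + 1) * (d true * d false) ^ (D - l.length) * (l.map fun σ => d (!σ.1) ^ 2).prod

/-- The group element at position `0` of the `a`-line over a syllable sequence. -/
def lineBase {G : Type*} [Group G] (a b : G) : List Syllable → G
  | [] => 1
  | σ :: l => lineBase a b l * a ^ σ.2 * if σ.1 then b else b⁻¹

/-- The endpoint over the shorter syllable sequence of the `j`-th edge between the line over `l`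
and the line over `σ :: l`. -/
def parentEnd (d : Bool → ℕ) (e : (_ : (_ : List Syllable) × Syllable) × ℕ) :
    (_ : List Syllable) × ℕ :=
  ⟨e.1.1, e.1.2.2 + d e.1.2.1 * e.2⟩

/-- The endpoint over the longer syllable sequence of the `j`-th edge between the line over `l`
and the line over `σ :: l`. -/
def childEnd (d : Bool → ℕ) (e : (_ : (_ : List Syllable) × Syllable) × ℕ) :
    (_ : List Syllable) × ℕ :=
  ⟨e.1.2 :: e.1.1, d (!e.1.2.1) * e.2⟩

/-- The child end of the edges with sign `β` and the parent end of the others. As these edges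
traverse `b` or `b⁻¹` from parent to child according to their sign, this is the end point of the
edge labelled `b` for `β = true` and its starting point for `β = false`. -/
def lineEdgeEnd (d : Bool → ℕ) (β : Bool) (e : (_ : (_ : List Syllable) × Syllable) × ℕ) :
    (_ : List Syllable) × ℕ :=
  if e.1.2.1 = β then childEnd d e else parentEnd d e

section LineEdges

variable {d : Bool → ℕ}

theorem le_numPeriods (hd : ∀ ε, 0 < d ε) (D : ℕ) (l : List Syllable) :
    D + 1 ≤ numPeriods d D l := by
  have hprod : 0 < (l.map fun σ => d (!σ.1) ^ 2).prod := by
    refine List.prod_pos fun x hx => ?_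
    obtain ⟨σ, -, rfl⟩ := List.mem_map.1 hx
    exact pow_pos (hd _) 2
  have hpow : 0 < (d true * d false) ^ (D - l.length) := pow_pos (mul_pos (hd _) (hd _)) _
  rw [numPeriods, mul_assoc]
  exact Nat.le_mul_of_pos_right _ (mul_pos hpow hprod)

theorem mul_numPeriods_cons {D : ℕ} {l : List Syllable} (hl : l.length < D) (σ : Syllable) :
    d σ.1 * numPeriods d D (σ :: l) = d (!σ.1) * numPeriods d D l := by
  obtain ⟨k, rfl⟩ := Nat.exists_eq_add_of_lt hl
  simp only [numPeriods, List.length_cons, List.map_cons, List.prod_cons,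
    show l.length + k + 1 - (l.length + 1) = k by omega,
    show l.length + k + 1 - l.length = k + 1 by omega, pow_succ _ k]
  rw [← mul_not_eq d σ.1]
  ring

theorem childEnd_injective (hd : ∀ ε, 0 < d ε) : Function.Injective (childEnd d) := by
  rintro ⟨⟨l, σ⟩, j⟩ ⟨⟨l', σ'⟩, j'⟩ h
  simp only [childEnd, Sigma.mk.injEq, List.cons.injEq, heq_eq_eq] at h
  obtain ⟨⟨rfl, rfl⟩, hj⟩ := h
  rw [Nat.eq_of_mul_eq_mul_left (hd _) hj]

theorem eq_of_parentEnd_eq (hd : ∀ ε, 0 < d ε) {e e' : (_ : (_ : List Syllable) × Syllable) × ℕ}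
    (he : e.1.2.2 < d e.1.2.1) (he' : e'.1.2.2 < d e'.1.2.1) (hsign : e.1.2.1 = e'.1.2.1)
    (h : parentEnd d e = parentEnd d e') : e = e' := by
  obtain ⟨⟨l, ε, r⟩, j⟩ := e
  obtain ⟨⟨l', ε', r'⟩, j'⟩ := e'
  simp only [parentEnd, Sigma.mk.injEq, heq_eq_eq] at he he' hsign h
  obtain ⟨rfl, hpos⟩ := h
  subst hsign
  have hmod := congrArg (· % d ε) hpos
  simp only [Nat.add_mul_mod_self_left, Nat.mod_eq_of_lt he, Nat.mod_eq_of_lt he'] at hmod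
  subst hmod
  rw [Nat.eq_of_mul_eq_mul_left (hd ε) (Nat.add_left_cancel hpos)]

theorem parentEnd_ne_childEnd {e e' : (_ : (_ : List Syllable) × Syllable) × ℕ}
    (he : e.1.2 ∈ nextSyllables d (lastSign e.1.1)) (hsign : e.1.2.1 ≠ e'.1.2.1) :
    parentEnd d e ≠ childEnd d e' := by
  obtain ⟨⟨l, ε, r⟩, j⟩ := e
  obtain ⟨⟨l', ε', r'⟩, j'⟩ := e'
  intro h
  simp only [parentEnd, childEnd, Sigma.mk.injEq, heq_eq_eq] at hsign h
  obtain ⟨rfl, hpos⟩ := h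
  obtain ⟨hlt, hne⟩ := mem_nextSyllables.1 he
  rw [← Bool.eq_not_of_ne hsign] at hpos
  have hmod := congrArg (· % d ε) hpos
  simp only [Nat.add_mul_mod_self_left, Nat.mul_mod_right, Nat.mod_eq_of_lt hlt] at hmod
  exact (hne hsign).ne' hmod

theorem lineEdgeEnd_injOn (hd : ∀ ε, 0 < d ε) (β : Bool) :
    Set.InjOn (lineEdgeEnd d β) {e | e.1.2 ∈ nextSyllables d (lastSign e.1.1)} := by
  intro e he e' he' h
  by_cases hβ : e.1.2.1 = β <;> by_cases hβ' : e'.1.2.1 = β <;>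
    simp only [lineEdgeEnd, hβ, hβ', if_true, if_false] at h
  · exact childEnd_injective hd h
  · exact absurd h.symm (parentEnd_ne_childEnd he' fun h' => hβ' (h'.trans hβ))
  · exact absurd h (parentEnd_ne_childEnd he fun h' => hβ (h'.trans hβ'))
  · exact eq_of_parentEnd_eq hd (mem_nextSyllables.1 he).1 (mem_nextSyllables.1 he').1
      ((Bool.eq_not_of_ne hβ).trans (Bool.eq_not_of_ne hβ').symm) h

theorem lineBase_cons_mul_pow {G : Type*} [Group G] {a b : G}
    (hrel : a ^ d true * b = b * a ^ d false) (l : List Syllable) (σ : Syllable) (j : ℕ) :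
    lineBase a b (σ :: l) * a ^ (d (!σ.1) * j) =
      lineBase a b l * a ^ (σ.2 + d σ.1 * j) * if σ.1 then b else b⁻¹ := by
  have hsemi : SemiconjBy b (a ^ (d false * j)) (a ^ (d true * j)) := by
    rw [pow_mul, pow_mul]
    exact SemiconjBy.pow_right hrel.symm j
  obtain ⟨ε, r⟩ := σ
  cases ε
  · simp only [lineBase, Bool.false_eq_true, if_false, Bool.not_false, pow_add, mul_assoc,
      hsemi.inv_symm_left.eq]
  · simp only [lineBase, if_true, Bool.not_true, pow_add, mul_assoc, hsemi.eq]

end LineEdges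

section LineImmersion

variable {G : Type} [Group G] {s : Fin 2 → G} {d : Bool → ℕ}

theorem value_lineEdgeEnd (hrel : s 0 ^ d true * s 1 = s 1 * s 0 ^ d false)
    (e : (_ : (_ : List Syllable) × Syllable) × ℕ) :
    lineBase (s 0) (s 1) (lineEdgeEnd d true e).1 * s 0 ^ (lineEdgeEnd d true e).2 =
      lineBase (s 0) (s 1) (lineEdgeEnd d false e).1 * s 0 ^ (lineEdgeEnd d false e).2 * s 1 := by
  obtain ⟨⟨l, ε, r⟩, j⟩ := e
  have h := lineBase_cons_mul_pow hrel l (ε, r) j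
  cases ε
  · simpa [lineEdgeEnd, childEnd, parentEnd, ← eq_mul_inv_iff_mul_eq] using h.symm
  · simpa [lineEdgeEnd, childEnd, parentEnd] using h

theorem lineEdgeEnd_mem (hd : ∀ ε, 0 < d ε) {D : ℕ} (β : Bool)
    {e : (_ : (_ : List Syllable) × Syllable) × ℕ} (hl : e.1.1 ∈ reducedSyllablesLT d D)
    (hσ : e.1.2 ∈ nextSyllables d (lastSign e.1.1))
    (hj : e.2 < d (!e.1.2.1) * numPeriods d D e.1.1) :
    lineEdgeEnd d β e ∈ (reducedSyllablesLT d (D + 1)).sigma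
      fun l => Finset.range (d true * d false * numPeriods d D l) := by
  obtain ⟨⟨l, σ⟩, j⟩ := e
  dsimp only at hl hσ hj
  simp only [lineEdgeEnd, Finset.mem_sigma, Finset.mem_range, childEnd, parentEnd]
  split_ifs
  · refine ⟨cons_mem_reducedSyllablesLT hl hσ, ?_⟩
    rw [← mul_numPeriods_cons (length_lt_of_mem_reducedSyllablesLT hl)] at hj
    rw [← mul_not_eq d σ.1, mul_comm (d σ.1), mul_assoc]
    exact Nat.mul_lt_mul_of_pos_left hj (hd _)
  · refine ⟨reducedSyllablesLT_subset_succ _ hl, ?_⟩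
    calc σ.2 + d σ.1 * j < d σ.1 * (j + 1) := by linarith [(mem_nextSyllables.1 hσ).1]
      _ ≤ d σ.1 * (d (!σ.1) * numPeriods d D l) := Nat.mul_le_mul_left _ hj
      _ = d true * d false * numPeriods d D l := by rw [← mul_assoc, mul_not_eq]

theorem injOn_sumElim_label {E F V : Type*} {A : Finset E} {B : Finset F} {f : E → V} {g : F → V}
    (hf : Set.InjOn f A) (hg : Set.InjOn g B) :
    Set.InjOn (fun e => ((Sum.elim (fun _ => 0) (fun _ => 1) e : Fin 2), Sum.elim f g e))
      (A.disjSum B) := by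
  rintro (x | x) hx (y | y) hy h <;>
    simp only [Finset.mem_coe, Finset.inl_mem_disjSum, Finset.inr_mem_disjSum, Sum.elim_inl,
      Sum.elim_inr, Prod.mk.injEq, zero_ne_one, one_ne_zero, true_and, false_and] at hx hy h
  · exact congrArg Sum.inl (hf hx hy h)
  · exact congrArg Sum.inr (hg hx hy h)

/-- Segments of the `a`-lines over the reduced sequences of at most `D` syllables. The edges
labelled `a` omit the last period of each segment, which makes their number exact. -/
def lineImmersion (hd : ∀ ε, 0 < d ε) (hrel : s 0 ^ d true * s 1 = s 1 * s 0 ^ d false) (D : ℕ) :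
    CayleyImmersion s ((_ : List Syllable) × ℕ)
      ((_ : List Syllable) × ℕ ⊕ (_ : (_ : List Syllable) × Syllable) × ℕ) where
  verts := (reducedSyllablesLT d (D + 1)).sigma
    fun l => Finset.range (d true * d false * numPeriods d D l)
  edges := ((reducedSyllablesLT d (D + 1)).sigma
      fun l => Finset.range (d true * d false * (numPeriods d D l - 1))).disjSum
    (((reducedSyllablesLT d D).sigma fun l => nextSyllables d (lastSign l)).sigma
      fun x => Finset.range (d (!x.2.1) * numPeriods d D x.1))
  label := Sum.elim (fun _ => 0) fun _ => 1
  src := Sum.elim id (lineEdgeEnd d false)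
  tgt := Sum.elim (fun v => ⟨v.1, v.2 + 1⟩) (lineEdgeEnd d true)
  value v := lineBase (s 0) (s 1) v.1 * s 0 ^ v.2
  src_mem := by
    rintro (⟨l, m⟩ | ⟨⟨l, σ⟩, j⟩) he <;>
      simp only [Finset.inl_mem_disjSum, Finset.inr_mem_disjSum, Finset.mem_sigma,
        Finset.mem_range] at he
    · exact Finset.mem_sigma.2 ⟨he.1, Finset.mem_range.2
        (he.2.trans_le (Nat.mul_le_mul_left _ (Nat.sub_le _ _)))⟩
    · exact lineEdgeEnd_mem hd false he.1.1 he.1.2 he.2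
  tgt_mem := by
    rintro (⟨l, m⟩ | ⟨⟨l, σ⟩, j⟩) he <;>
      simp only [Finset.inl_mem_disjSum, Finset.inr_mem_disjSum, Finset.mem_sigma,
        Finset.mem_range] at he
    · have hlt : numPeriods d D l - 1 < numPeriods d D l :=
        Nat.sub_one_lt_of_lt (le_numPeriods hd D l)
      exact Finset.mem_sigma.2 ⟨he.1, Finset.mem_range.2 (lt_of_le_of_lt he.2
        (Nat.mul_lt_mul_of_pos_left hlt (mul_pos (hd _) (hd _))))⟩
    · exact lineEdgeEnd_mem hd true he.1.1 he.1.2 he.2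
  value_tgt := by
    rintro (⟨l, m⟩ | e) -
    · simp [pow_succ, mul_assoc]
    · exact value_lineEdgeEnd hrel e
  injOn_src := injOn_sumElim_label Function.injective_id.injOn
    ((lineEdgeEnd_injOn hd false).mono fun _ he =>
      (Finset.mem_sigma.1 (Finset.mem_sigma.1 (Finset.mem_coe.1 he)).1).2)
  injOn_tgt := injOn_sumElim_label (Function.Injective.injOn fun _ _ h => by
      simpa [Sigma.ext_iff] using h)
    ((lineEdgeEnd_injOn hd true).mono fun _ he =>
      (Finset.mem_sigma.1 (Finset.mem_sigma.1 (Finset.mem_coe.1 he)).1).2)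

end LineImmersion

/-- The amplitude of a syllable sequence for given transition amplitudes `w`. -/
noncomputable def amplitude (w : Bool → Syllable → ℝ) : List Syllable → ℝ
  | [] => 1
  | σ :: l => amplitude w l * w (lastSign l) σ

/-- The vector on the vertices of a line immersion that is the profile `u τ` along a line whose
last syllable has sign `τ`, scaled by the amplitude of the line. -/
noncomputable def lineState (u : Bool → ℕ → ℝ) (w : Bool → Syllable → ℝ)
    (v : (_ : List Syllable) × ℕ) : ℝ :=
  amplitude w v.1 * u (lastSign v.1) v.2

/-- The squared norm of one period of the profile `u τ`. -/
noncomputable def lineNorm (d : Bool → ℕ) (u : Bool → ℕ → ℝ) (τ : Bool) : ℝ :=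
  ∑ m ∈ Finset.range (d true * d false), u τ m ^ 2

/-- The contribution of the edges labelled `a` along one period of the profile `u τ`. -/
noncomputable def lineCorrelation (d : Bool → ℕ) (u : Bool → ℕ → ℝ) (τ : Bool) : ℝ :=
  ∑ m ∈ Finset.range (d true * d false), u τ m * u τ (m + 1)

/-- The contribution of the edges labelled `b` that join one period of the profile `u τ` to the
lines over longer syllable sequences. -/
noncomputable def branchCorrelation (d : Bool → ℕ) (u : Bool → ℕ → ℝ) (w : Bool → Syllable → ℝ)
    (τ : Bool) : ℝ :=
  ∑ σ ∈ nextSyllables d τ,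
    w τ σ * ((∑ j ∈ Finset.range (d (!σ.1)), u τ (σ.2 + d σ.1 * j)) * u σ.1 0)

/-- The squared amplitude of a line of a line immersion, counted once for each period. -/
noncomputable def lineMass (d : Bool → ℕ) (w : Bool → Syllable → ℝ) (D : ℕ) (l : List Syllable) :
    ℝ :=
  amplitude w l ^ 2 * numPeriods d D l

section LineState

variable {G : Type} [Group G] {s : Fin 2 → G} {d : Bool → ℕ} {u : Bool → ℕ → ℝ}
  {w : Bool → Syllable → ℝ} {D : ℕ}

theorem periodic_profile (hu : ∀ τ, Function.Periodic (u τ) (d (!τ))) (τ : Bool) :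
    Function.Periodic (u τ) (d true * d false) := by
  rw [← mul_not_eq d τ]
  exact (hu τ).nat_mul _

theorem sum_verts_lineImmersion (hd : ∀ ε, 0 < d ε)
    (hrel : s 0 ^ d true * s 1 = s 1 * s 0 ^ d false)
    (hu : ∀ τ, Function.Periodic (u τ) (d (!τ))) :
    ∑ v ∈ (lineImmersion hd hrel D).verts, lineState u w v ^ 2 =
      ∑ l ∈ reducedSyllablesLT d (D + 1), lineMass d w D l * lineNorm d u (lastSign l) := by
  rw [lineImmersion, Finset.sum_sigma]
  refine Finset.sum_congr rfl fun l _ => ?_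
  simp only [lineState, mul_pow, ← Finset.mul_sum]
  have hper : Function.Periodic (fun m => u (lastSign l) m ^ 2) (d true * d false) := fun m => by
    simp only [periodic_profile hu _ _]
  rw [sum_range_mul_of_periodic hper, lineMass, lineNorm, mul_assoc]

theorem sum_lineState_mul_succ (hu : ∀ τ, Function.Periodic (u τ) (d (!τ))) (l : List Syllable)
    (n : ℕ) :
    ∑ m ∈ Finset.range (d true * d false * n), lineState u w ⟨l, m⟩ * lineState u w ⟨l, m + 1⟩ =
      amplitude w l ^ 2 * n * lineCorrelation d u (lastSign l) := by
  have hper : Function.Periodic (fun m => u (lastSign l) m * u (lastSign l) (m + 1))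
      (d true * d false) := fun m => by
    simp only [add_right_comm m _ 1, periodic_profile hu _ _]
  rw [lineCorrelation, mul_assoc (amplitude w l ^ 2), ← sum_range_mul_of_periodic hper,
    Finset.mul_sum]
  exact Finset.sum_congr rfl fun m _ => by simp only [lineState]; ring

theorem lineState_lineEdgeEnd_mul (hu : ∀ τ, Function.Periodic (u τ) (d (!τ)))
    (e : (_ : (_ : List Syllable) × Syllable) × ℕ) :
    lineState u w (lineEdgeEnd d false e) * lineState u w (lineEdgeEnd d true e) =
      amplitude w e.1.1 ^ 2 * w (lastSign e.1.1) e.1.2 *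
        (u (lastSign e.1.1) (e.1.2.2 + d e.1.2.1 * e.2) * u e.1.2.1 0) := by
  obtain ⟨⟨l, ε, r⟩, j⟩ := e
  have hchild : u ε (d (!ε) * j) = u ε 0 := by
    rw [mul_comm]
    exact (hu ε).nat_mul_eq j
  cases ε <;>
    simp only [lineEdgeEnd, childEnd, parentEnd, lineState, amplitude, lastSign, hchild,
      Bool.true_eq_false, Bool.false_eq_true, if_true, if_false] <;> ring

theorem sum_lineState_branch (hu : ∀ τ, Function.Periodic (u τ) (d (!τ))) (l : List Syllable)
    (n : ℕ) :
    ∑ σ ∈ nextSyllables d (lastSign l), ∑ j ∈ Finset.range (d (!σ.1) * n),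
      lineState u w (lineEdgeEnd d false ⟨⟨l, σ⟩, j⟩) *
        lineState u w (lineEdgeEnd d true ⟨⟨l, σ⟩, j⟩) =
      amplitude w l ^ 2 * n * branchCorrelation d u w (lastSign l) := by
  rw [branchCorrelation, Finset.mul_sum]
  refine Finset.sum_congr rfl fun σ _ => ?_
  have hper : Function.Periodic (fun j => u (lastSign l) (σ.2 + d σ.1 * j)) (d (!σ.1)) :=
    fun j => by simp only [mul_add, ← add_assoc, mul_not_eq, periodic_profile hu _ _]
  simp only [lineState_lineEdgeEnd_mul hu, ← Finset.mul_sum, ← Finset.sum_mul]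
  rw [sum_range_mul_of_periodic hper]
  ring

theorem lineImmersion_rayleigh (hd : ∀ ε, 0 < d ε)
    (hrel : s 0 ^ d true * s 1 = s 1 * s 0 ^ d false)
    (hu : ∀ τ, Function.Periodic (u τ) (d (!τ))) :
    2 * (∑ l ∈ reducedSyllablesLT d (D + 1),
        (lineMass d w D l - amplitude w l ^ 2) * lineCorrelation d u (lastSign l) +
      ∑ l ∈ reducedSyllablesLT d D, lineMass d w D l * branchCorrelation d u w (lastSign l)) ≤
      rho s * ∑ l ∈ reducedSyllablesLT d (D + 1),
        lineMass d w D l * lineNorm d u (lastSign l) := by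
  have hcast : ∀ l, ((numPeriods d D l - 1 : ℕ) : ℝ) = numPeriods d D l - 1 := fun l =>
    Nat.cast_pred ((Nat.succ_pos D).trans_le (le_numPeriods hd D l))
  rw [← sum_verts_lineImmersion hd hrel hu]
  refine le_trans (le_of_eq ?_) ((lineImmersion hd hrel D).two_mul_sum_edges_le (lineState u w))
  simp only [lineImmersion, Finset.sum_disjSum, Finset.sum_sigma, Sum.elim_inl, Sum.elim_inr, id,
    sum_lineState_mul_succ hu, sum_lineState_branch hu, hcast, lineMass, mul_sub, mul_one]

theorem lineMass_nonneg (l : List Syllable) : 0 ≤ lineMass d w D l := by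
  unfold lineMass
  positivity

theorem sum_lineMass_cons_le (hd : ∀ ε, 0 < d ε)
    (hw : ∀ τ, ∑ σ ∈ nextSyllables d τ, w τ σ ^ 2 * (d (!σ.1) / d σ.1) ≤ 1) {l : List Syllable}
    (hl : l.length < D) :
    ∑ σ ∈ nextSyllables d (lastSign l), lineMass d w D (σ :: l) ≤ lineMass d w D l := by
  have hterm : ∀ σ, lineMass d w D (σ :: l) =
      lineMass d w D l * (w (lastSign l) σ ^ 2 * (d (!σ.1) / d σ.1)) := by
    intro σ
    have hdσ : (d σ.1 : ℝ) ≠ 0 := Nat.cast_ne_zero.2 (hd _).ne'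
    have hcons : (d σ.1 : ℝ) * numPeriods d D (σ :: l) = d (!σ.1) * numPeriods d D l := by
      exact_mod_cast mul_numPeriods_cons hl σ
    rw [lineMass, lineMass, amplitude, eq_div_of_mul_eq hdσ ((mul_comm _ _).trans hcons)]
    ring
  simp only [hterm, ← Finset.mul_sum]
  exact mul_le_of_le_one_right (lineMass_nonneg l) (hw _)

theorem succ_mul_sum_lineMass_le (hd : ∀ ε, 0 < d ε)
    (hw : ∀ τ, ∑ σ ∈ nextSyllables d τ, w τ σ ^ 2 * (d (!σ.1) / d σ.1) ≤ 1) :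
    (D + 1) * ∑ l ∈ reducedSyllables d D, lineMass d w D l ≤
      ∑ l ∈ reducedSyllablesLT d (D + 1), lineMass d w D l := by
  have hlevel : ∀ k ≤ D, ∑ l ∈ reducedSyllables d D, lineMass d w D l ≤
      ∑ l ∈ reducedSyllables d k, lineMass d w D l := by
    intro k hk
    induction hk using Nat.decreasingInduction with
    | self => exact le_rfl
    | of_succ k hk ih =>
      refine ih.trans ?_
      rw [sum_reducedSyllables_succ]
      exact Finset.sum_le_sum fun l hl =>
        sum_lineMass_cons_le hd hw ((length_of_mem_reducedSyllables hl).trans_lt hk)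
  rw [sum_reducedSyllablesLT, ← Nat.cast_succ, ← nsmul_eq_mul]
  simpa using Finset.card_nsmul_le_sum (Finset.range (D + 1)) _ _ fun k hk =>
    hlevel k (Nat.lt_succ_iff.1 (Finset.mem_range.1 hk))

theorem succ_mul_sum_amplitude_sq_le (hd : ∀ ε, 0 < d ε) (A : Finset (List Syllable)) :
    (D + 1) * ∑ l ∈ A, amplitude w l ^ 2 ≤ ∑ l ∈ A, lineMass d w D l := by
  rw [Finset.mul_sum]
  refine Finset.sum_le_sum fun l _ => ?_
  have hle : (D + 1 : ℝ) ≤ numPeriods d D l := by exact_mod_cast le_numPeriods hd D l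
  rw [lineMass, mul_comm]
  gcongr

theorem sum_lineMass_pos (hd : ∀ ε, 0 < d ε) :
    0 < ∑ l ∈ reducedSyllablesLT d (D + 1), lineMass d w D l := by
  have hnil : [] ∈ reducedSyllablesLT d (D + 1) :=
    Finset.mem_biUnion.2 ⟨0, Finset.mem_range.2 D.succ_pos, Finset.mem_singleton_self _⟩
  refine Finset.sum_pos' (fun l _ => lineMass_nonneg l) ⟨[], hnil, ?_⟩
  have hpos : 0 < numPeriods d D [] := D.succ_pos.trans_le (le_numPeriods hd D [])
  simpa [lineMass, amplitude] using hpos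

theorem sub_rho_mul_sum_lineNorm_le (hd : ∀ ε, 0 < d ε)
    (hrel : s 0 ^ d true * s 1 = s 1 * s 0 ^ d false)
    (hu : ∀ τ, Function.Periodic (u τ) (d (!τ))) {c : ℝ}
    (hc : ∀ τ, c * lineNorm d u τ ≤ 2 * (lineCorrelation d u τ + branchCorrelation d u w τ)) :
    (c - rho s) * ∑ l ∈ reducedSyllablesLT d (D + 1), lineMass d w D l * lineNorm d u (lastSign l) ≤
      2 * (∑ l ∈ reducedSyllablesLT d (D + 1),
          amplitude w l ^ 2 * lineCorrelation d u (lastSign l) +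
        ∑ l ∈ reducedSyllables d D, lineMass d w D l * branchCorrelation d u w (lastSign l)) := by
  have hlocal := Finset.sum_le_sum fun l (_ : l ∈ reducedSyllablesLT d (D + 1)) =>
    mul_le_mul_of_nonneg_left (hc (lastSign l)) (lineMass_nonneg (d := d) (w := w) (D := D) l)
  have hrayleigh := lineImmersion_rayleigh (w := w) (D := D) hd hrel hu
  have hsplit : ∑ l ∈ reducedSyllablesLT d (D + 1),
        lineMass d w D l * branchCorrelation d u w (lastSign l) =
      ∑ l ∈ reducedSyllablesLT d D, lineMass d w D l * branchCorrelation d u w (lastSign l) +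
        ∑ l ∈ reducedSyllables d D, lineMass d w D l * branchCorrelation d u w (lastSign l) := by
    simp only [sum_reducedSyllablesLT, Finset.sum_range_succ]
  simp only [mul_left_comm _ c, mul_left_comm _ (2 : ℝ), mul_add, ← Finset.mul_sum,
    Finset.sum_add_distrib, hsplit] at hlocal
  simp only [sub_mul, Finset.sum_sub_distrib] at hrayleigh ⊢
  linarith

theorem succ_mul_sum_boundary_le (hd : ∀ ε, 0 < d ε)
    (hw : ∀ τ, ∑ σ ∈ nextSyllables d τ, w τ σ ^ 2 * (d (!σ.1) / d σ.1) ≤ 1)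
    {f g : Bool → ℝ} {K : ℝ} (hK : 0 ≤ K) (hf : ∀ τ, f τ ≤ K) (hg : ∀ τ, g τ ≤ K) :
    (D + 1) * (∑ l ∈ reducedSyllablesLT d (D + 1), amplitude w l ^ 2 * f (lastSign l) +
        ∑ l ∈ reducedSyllables d D, lineMass d w D l * g (lastSign l)) ≤
      2 * K * ∑ l ∈ reducedSyllablesLT d (D + 1), lineMass d w D l := by
  set A := reducedSyllablesLT d (D + 1)
  set B := reducedSyllables d D
  calc (D + 1) * (∑ l ∈ A, amplitude w l ^ 2 * f (lastSign l) +
        ∑ l ∈ B, lineMass d w D l * g (lastSign l))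
      ≤ (D + 1) * (∑ l ∈ A, amplitude w l ^ 2 * K + ∑ l ∈ B, lineMass d w D l * K) := by
        gcongr with l _ l _
        exacts [hf _, lineMass_nonneg l, hg _]
    _ = (D + 1) * (∑ l ∈ A, amplitude w l ^ 2) * K + (D + 1) * (∑ l ∈ B, lineMass d w D l) * K := by
        rw [← Finset.sum_mul, ← Finset.sum_mul]
        ring
    _ ≤ (∑ l ∈ A, lineMass d w D l) * K + (∑ l ∈ A, lineMass d w D l) * K := by
        gcongr
        exacts [succ_mul_sum_amplitude_sq_le hd A, succ_mul_sum_lineMass_le hd hw]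
    _ = 2 * K * ∑ l ∈ A, lineMass d w D l := by ring

theorem le_rho_of_lineState (hd : ∀ ε, 0 < d ε)
    (hrel : s 0 ^ d true * s 1 = s 1 * s 0 ^ d false)
    (hu : ∀ τ, Function.Periodic (u τ) (d (!τ))) (hnorm : ∀ τ, 0 < lineNorm d u τ)
    (hw : ∀ τ, ∑ σ ∈ nextSyllables d τ, w τ σ ^ 2 * (d (!σ.1) / d σ.1) ≤ 1) {c : ℝ}
    (hc : ∀ τ, c * lineNorm d u τ ≤ 2 * (lineCorrelation d u τ + branchCorrelation d u w τ)) :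
    c ≤ rho s := by
  by_contra! hlt
  obtain ⟨N, hN, hN_le⟩ : ∃ N > 0, ∀ τ, N ≤ lineNorm d u τ :=
    ⟨min (lineNorm d u true) (lineNorm d u false), lt_min (hnorm _) (hnorm _), by simp⟩
  obtain ⟨K, hK⟩ : ∃ K, ∀ τ, max 0 (max (lineCorrelation d u τ) (branchCorrelation d u w τ)) ≤ K :=
    Finite.exists_le _
  simp only [max_le_iff] at hK
  suffices hbound : ∀ D : ℕ, D * ((c - rho s) * N) ≤ 4 * K from
    (mul_pos (sub_pos.2 hlt) hN).not_ge (nonpos_of_forall_nat_mul_le hbound)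
  intro D
  set A := reducedSyllablesLT d (D + 1)
  refine le_of_mul_le_mul_right ?_ (sum_lineMass_pos (w := w) (D := D) hd)
  have hgap : 0 ≤ c - rho s := (sub_pos.2 hlt).le
  have hmass : 0 ≤ ∑ l ∈ A, lineMass d w D l := (sum_lineMass_pos hd).le
  have hnorm_sum : (∑ l ∈ A, lineMass d w D l) * N ≤
      ∑ l ∈ A, lineMass d w D l * lineNorm d u (lastSign l) := by
    rw [Finset.sum_mul]
    exact Finset.sum_le_sum fun l _ => mul_le_mul_of_nonneg_left (hN_le _) (lineMass_nonneg l)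
  calc D * ((c - rho s) * N) * ∑ l ∈ A, lineMass d w D l
      ≤ (D + 1) * ((c - rho s) * ((∑ l ∈ A, lineMass d w D l) * N)) := by
        rw [mul_assoc, mul_assoc, mul_comm N]
        exact mul_le_mul_of_nonneg_right (le_add_of_nonneg_right zero_le_one)
          (mul_nonneg hgap (mul_nonneg hmass hN.le))
    _ ≤ (D + 1) * ((c - rho s) * ∑ l ∈ A, lineMass d w D l * lineNorm d u (lastSign l)) := by
        gcongr
    _ ≤ (D + 1) * (2 * (∑ l ∈ A, amplitude w l ^ 2 * lineCorrelation d u (lastSign l) +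
          ∑ l ∈ reducedSyllables d D,
            lineMass d w D l * branchCorrelation d u w (lastSign l))) :=
        mul_le_mul_of_nonneg_left (sub_rho_mul_sum_lineNorm_le hd hrel hu hc) (by positivity)
    _ ≤ 4 * K * ∑ l ∈ A, lineMass d w D l := by
        linarith [succ_mul_sum_boundary_le (D := D) hd hw (hK true).1 (fun τ => (hK τ).2.1)
          fun τ => (hK τ).2.2]

end LineState

/-- The moduli of the exponents before `b` and before `b⁻¹` in `BS(p,q)`, where the relation reads
`a ^ q * b = b * a ^ p`. -/
def bsModulus (p q : ℕ) (ε : Bool) : ℕ := if ε then q else p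

/-- The profile with value `x τ` at the positions of a line that are joined to the line over the
shorter syllable sequence, and `y τ` at the others. -/
noncomputable def twoValued (d : Bool → ℕ) (x y : Bool → ℝ) (τ : Bool) (m : ℕ) : ℝ :=
  if d (!τ) ∣ m then x τ else y τ

theorem bsGen_relation (p q : ℕ) :
    bsGen p q 0 ^ q * bsGen p q 1 = bsGen p q 1 * bsGen p q 0 ^ p := by
  have h : PresentedGroup.mk ({fb * fa ^ p * fb⁻¹ * (fa ^ q)⁻¹} : Set (FreeGroup (Fin 2)))
      (fb * fa ^ p * fb⁻¹ * (fa ^ q)⁻¹) = 1 := PresentedGroup.one_of_mem rfl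
  simp only [map_mul, map_pow, map_inv] at h
  rw [mul_inv_eq_one, mul_inv_eq_iff_eq_mul] at h
  exact h.symm

theorem lineNorm_twoValued_pos {d : Bool → ℕ} (hd : ∀ ε, 0 < d ε) {x : Bool → ℝ}
    (hx : ∀ τ, x τ ≠ 0) (y : Bool → ℝ) (τ : Bool) : 0 < lineNorm d (twoValued d x y) τ := by
  refine Finset.sum_pos' (fun _ _ => sq_nonneg _)
    ⟨0, Finset.mem_range.2 (mul_pos (hd _) (hd _)), ?_⟩
  simpa [twoValued, sq_pos_iff] using hx τ

theorem le_rho_bsGen {p q : ℕ} (hp : 0 < p) (hq : 0 < q) {x : Bool → ℝ} (hx : ∀ τ, x τ ≠ 0)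
    (y : Bool → ℝ) (w : Bool → Syllable → ℝ)
    (hw : ∀ τ, ∑ σ ∈ nextSyllables (bsModulus p q) τ,
      w τ σ ^ 2 * (bsModulus p q (!σ.1) / bsModulus p q σ.1) ≤ 1) {c : ℝ}
    (hc : ∀ τ, c * lineNorm (bsModulus p q) (twoValued (bsModulus p q) x y) τ ≤
      2 * (lineCorrelation (bsModulus p q) (twoValued (bsModulus p q) x y) τ +
        branchCorrelation (bsModulus p q) (twoValued (bsModulus p q) x y) w τ)) :
    c ≤ rho (bsGen p q) := by
  have hd : ∀ ε, 0 < bsModulus p q ε := by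
    rintro (_ | _)
    exacts [hp, hq]
  exact le_rho_of_lineState hd (bsGen_relation p q) (fun τ m => by simp [twoValued])
    (lineNorm_twoValued_pos hd hx y) hw hc

theorem le_rho_bsGen_two_two : 3.787 ≤ rho (bsGen 2 2) := by
  refine le_rho_bsGen (by norm_num) (by norm_num) (x := fun _ => 1) (fun _ => one_ne_zero)
    (fun _ => 4 / 5) (fun τ σ => if σ.1 = τ ∧ σ.2 = 0 then 33 / 50 else 53 / 100)
    (fun τ => ?_) fun τ => ?_
  · rw [sum_nextSyllables]
    cases τ <;> norm_num [bsModulus, Finset.sum_range_succ, Finset.sum_Ico_eq_sum_range]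
  · rw [lineNorm, lineCorrelation, branchCorrelation, sum_nextSyllables]
    cases τ <;> norm_num [bsModulus, twoValued, Finset.sum_range_succ, Finset.sum_Ico_eq_sum_range]

theorem le_rho_bsGen_two_three : 3.68 ≤ rho (bsGen 2 3) := by
  refine le_rho_bsGen (by norm_num) (by norm_num) (x := fun τ => if τ then 1 else 11 / 10)
    (fun τ => by split_ifs <;> norm_num) (fun _ => 4 / 5)
    (fun τ σ => if τ then (if σ.1 then 3 / 5 else 2 / 5) else (if σ.1 then 11 / 20 else 11 / 25))
    (fun τ => ?_) fun τ => ?_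
  · rw [sum_nextSyllables]
    cases τ <;> norm_num [bsModulus, Finset.sum_range_succ, Finset.sum_Ico_eq_sum_range]
  · rw [lineNorm, lineCorrelation, branchCorrelation, sum_nextSyllables]
    cases τ <;> norm_num [bsModulus, twoValued, Finset.sum_range_succ, Finset.sum_Ico_eq_sum_range]

theorem le_rho_bsGen_three_five : 3.53 ≤ rho (bsGen 3 5) := by
  refine le_rho_bsGen (by norm_num) (by norm_num) (x := fun τ => if τ then 1 else 11 / 10)
    (fun τ => by split_ifs <;> norm_num) (fun τ => if τ then 7 / 10 else 2 / 3)
    (fun τ σ => if τ then (if σ.1 then 49 / 100 else 7 / 25)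
      else (if σ.1 then 43 / 100 else 33 / 100)) (fun τ => ?_) fun τ => ?_
  · rw [sum_nextSyllables]
    cases τ <;> norm_num [bsModulus, Finset.sum_range_succ, Finset.sum_Ico_eq_sum_range]
  · rw [lineNorm, lineCorrelation, branchCorrelation, sum_nextSyllables]
    cases τ <;> norm_num [bsModulus, twoValued, Finset.sum_range_succ, Finset.sum_Ico_eq_sum_range]

end Cogrowth

/-- Lower bounds on the growth rates of the freely reduced trivial words and of all trivial words
in `BS(2,2)`, `BS(2,3)`, `BS(3,5)` and Thompson's group `F`. -/
theorem mainTheorem1 :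
    (2.5904 ≤ Cogrowth.alpha (Cogrowth.bsGen 2 2) ∧
      2.42579 ≤ Cogrowth.alpha (Cogrowth.bsGen 2 3) ∧
      2.06357 ≤ Cogrowth.alpha (Cogrowth.bsGen 3 5) ∧
      2.17329 ≤ Cogrowth.alpha Cogrowth.thompsonGen) ∧
    (3.78522 ≤ Cogrowth.rho (Cogrowth.bsGen 2 2) ∧
      3.66250 ≤ Cogrowth.rho (Cogrowth.bsGen 2 3) ∧
      3.51736 ≤ Cogrowth.rho (Cogrowth.bsGen 3 5) ∧
      3.55368 ≤ Cogrowth.rho Cogrowth.thompsonGen) := by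
  have h22 := Cogrowth.le_rho_bsGen_two_two
  have h23 := Cogrowth.le_rho_bsGen_two_three
  have h35 := Cogrowth.le_rho_bsGen_three_five
  have hF := Cogrowth.le_rho_thompsonGen
  refine ⟨⟨?_, ?_, ?_, ?_⟩, ?_, ?_, ?_, ?_⟩
  · exact Cogrowth.le_alpha_of_lt_rho (by norm_num) (lt_of_lt_of_le (by norm_num) h22)
  · exact Cogrowth.le_alpha_of_lt_rho (by norm_num) (lt_of_lt_of_le (by norm_num) h23)
  · exact Cogrowth.le_alpha_of_lt_rho (by norm_num) (lt_of_lt_of_le (by norm_num) h35)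
  · exact Cogrowth.le_alpha_of_lt_rho (by norm_num) (lt_of_lt_of_le (by norm_num) hF)
  · exact le_trans (by norm_num) h22
  · exact le_trans (by norm_num) h23
  · exact le_trans (by norm_num) h35
  · exact le_trans (by norm_num) hF
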